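/- Let $G=(V,E)$ be a chain graph: a finite graph with undirected and directed edges and no semi-directed cycle. Its chain components $T\in\mathcal T$ are the connected components left after removing the directed edges. Let $\prec$ be a consistent strict total order of the components, i.e. if $T\prec T'$ then no directed edge points from $T$ to $T'$; put $\mathrm{pre}(T)=\bigcup_{T\prec T'}T'$, and let $\mathrm{pa}_G(A)$ be the set of nodes $w\notin A$ with $w\to v$ for some $v\in A$. A set $A\subseteq T$ is connected if any two of its nodes are joined by a path inside $A$, and disconnected otherwise. Let $X=(X_v)_{v\in V}$ be discrete, $X_v$ having levels $1,\dots,r_v$ ($r_v\ge 1$), with $\mathcal I_B=\prod_{v\in B}\{1,\dots,r_v\}$, $\mathcal I_B^\star=\prod_{v\in B}\{2,\dots,r_v\}$ and $\mathcal I=\mathcal I_V$. The model $\mathbf P_{\mathrm{MR}}(G)$ is the set of strictly positive distributions $p$ on $\mathcal I$ such that for all $T\in\mathcal T$ and $A\subseteq T$: if $A$ is connected, then $A\perp\!\!\!\perp[\mathrm{pre}(T)\setminus\mathrm{pa}_G(A)]\mid\mathrm{pa}_G(A)$; if $A$ is disconnected with connected components $A_1,\dots,A_k$, then $A_1\perp\!\!\!\perp\cdots\perp\!\!\!\perp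 A_k\mid\mathrm{pre}(T)$. For strictly positive $p$, $\emptyset\ne A\subseteq T$, $i_A^\star\in\mathcal I_A^\star$ and $i_{\mathrm{pre}(T)}\in\mathcal I_{\mathrm{pre}(T)}$, put $$\eta^{(A)}(i_A^\star\mid i_{\mathrm{pre}(T)})=\sum_{s\subseteq A}(-1)^{|A\setminus s|}\log p(i_s^\star,1_{A\setminus s}\mid i_{\mathrm{pre}(T)}),$$ and consider the saturated regression $$\eta^{(A)}(i_A^\star\mid i_{\mathrm{pre}(T)})=\sum_{b\subseteq\mathrm{pre}(T)}\beta_b^{(A)}(i_A^\star,i_b),$$ where $\beta_b^{(A)}(i_A^\star,i_b)=0$ whenever some coordinate of $i_b$ is $1$ (baseline coding). Then: 1. Every strictly positive $p$ has exactly one such family $\beta$. 2. A strictly positive $p$ belongs to $\mathbf P_{\mathrm{MR}}(G)$ if and only if, for all $T\in\mathcal T$ and all nonempty $A\subseteq T$, $\beta_b^{(A)}$ vanishes identically whenever (i) $A$ is connected, $b\subseteq\mathrm{pre}(T)$ and $b\not\subseteq\mathrm{pa}_G(A)$, or (ii) $A$ is disconnected and $b\subseteq\mathrm{pre}(T)$.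 3. Write the strictly positive distributions as the exponential family with natural parameters $\theta_i=\log\bigl(p(i)/p(1,\dots,1)\bigr)$, $i\in\mathcal I\setminus\{(1,\dots,1)\}$. The map from $\theta$ to the coordinates $\beta^{(A)}_b(i_A^\star,i_b^\star)$ with $i_b^\star\in\mathcal I_b^\star$ is a $C^\infty$ diffeomorphism onto an open set, and $\mathbf P_{\mathrm{MR}}(G)$ consists of the distributions for which the coordinates listed in (i) and (ii) are $0$. Hence $\mathbf P_{\mathrm{MR}}(G)$ is defined by linear constraints in a multivariate logistic parameterization and is a curved exponential family, i.e. its set of natural parameters is an embedded smooth submanifold of the natural parameter space. -/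

import Mathlib

open scoped ContDiff

/-- A chain graph: undirected edges `undir`, directed edges `dir`, and no semi-directed cycle,
i.e. no closed path that contains a directed edge and traverses all its directed edges forwards. -/
structure ChainGraph (V : Type*) where
  undir : SimpleGraph V
  dir : V → V → Prop
  no_semidirected_cycle : ∀ v w, dir v w →
    ¬ Relation.ReflTransGen (fun a b => undir.Adj a b ∨ dir a b) w v

namespace ChainGraph

variable {V : Type*} [Fintype V] [DecidableEq V] (G : ChainGraph V)

/-- The chain components: connected components after removal of the directed edges. -/
abbrev Component {V : Type*} (G : ChainGraph V) : Type _ := G.undir.ConnectedComponent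

open scoped Classical in
/-- The node set of a chain component. -/
noncomputable def nodes (T : G.Component) : Finset V :=
  Finset.univ.filter fun v => G.undir.connectedComponentMk v = T

/-- `T₁ ⟶ T₂` in the directed graph of chain components. -/
def CompArrow {V : Type*} (G : ChainGraph V) (T₁ T₂ : G.Component) : Prop :=
  ∃ v w, G.undir.connectedComponentMk v = T₁ ∧ G.undir.connectedComponentMk w = T₂ ∧ G.dir v w

open scoped Classical in
/-- The parents of a set of nodes. -/
noncomputable def parents (A : Finset V) : Finset V :=
  Finset.univ.filter fun w => w ∉ A ∧ ∃ v ∈ A, G.dir w v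

/-- `A` is connected: any two nodes of `A` are joined by a path inside `A`. It is used for subsets
of chain components, where all edges are undirected. -/
def IsConn {V : Type*} (G : ChainGraph V) (A : Finset V) : Prop :=
  (G.undir.induce (A : Set V)).Preconnected

/-- `v` and `w` are joined by a path inside `A`. -/
def JoinedIn {V : Type*} (G : ChainGraph V) (A : Finset V) (v w : V) : Prop :=
  ∃ (hv : v ∈ (A : Set V)) (hw : w ∈ (A : Set V)),
    (G.undir.induce (A : Set V)).Reachable ⟨v, hv⟩ ⟨w, hw⟩

open scoped Classical in
/-- The node sets of the connected components `A₁, …, A_r` of `A`. -/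
noncomputable def pieces (A : Finset V) : Finset (Finset V) :=
  A.image fun v => A.filter fun w => G.JoinedIn A v w

/-- A strict total order `≺` of the chain components that is consistent with the graph: if
`T ≺ T'` then `T` is not a parent component of `T'` (so the past of `T` consists of the `T'`
with `T ≺ T'`). -/
structure ConsistentOrder {V : Type*} (G : ChainGraph V) where
  prec : G.Component → G.Component → Prop
  irrefl : ∀ T, ¬ prec T T
  trans : ∀ T₁ T₂ T₃, prec T₁ T₂ → prec T₂ T₃ → prec T₁ T₃
  total : ∀ T₁ T₂, T₁ ≠ T₂ → prec T₁ T₂ ∨ prec T₂ T₁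
  consistent : ∀ T T', prec T T' → ¬ G.CompArrow T T'

variable {G}

open scoped Classical in
/-- `pre(T)`, the union of all components `T'` with `T ≺ T'`. -/
noncomputable def ConsistentOrder.pre (o : G.ConsistentOrder) (T : G.Component) : Finset V :=
  Finset.univ.filter fun v => o.prec T (G.undir.connectedComponentMk v)

end ChainGraph

section Tables

variable {V : Type*} [Fintype V] [DecidableEq V] (r : V → ℕ)

/-- The cells of the contingency table; `X_v` has `r v` levels, the first of which is `0`. -/
abbrev Cell {V : Type*} (r : V → ℕ) : Type _ := ∀ v, Fin (r v)

/-- The cells of the marginal table `B`. -/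
abbrev SubCell {V : Type*} (r : V → ℕ) (B : Finset V) : Type _ := ∀ v : {v // v ∈ B}, Fin (r v)

/-- The cells of the marginal table `A` all of whose indices differ from the first level. -/
abbrev StarCell {V : Type*} (r : V → ℕ) [∀ v, NeZero (r v)] (A : Finset V) : Type _ :=
  ∀ v : {v // v ∈ A}, {x : Fin (r v) // x ≠ 0}

variable {r}

/-- Strictly positive probability mass functions. -/
def IsPositiveDist (p : Cell r → ℝ) : Prop := (∀ i, 0 < p i) ∧ ∑ i, p i = 1

/-- The marginal probability `p(i_B)`; it depends on the coordinates of `i` in `B` only. -/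
noncomputable def marg (p : Cell r → ℝ) (B : Finset V) (i : Cell r) : ℝ :=
  ∑ j ∈ Finset.univ.filter (fun j : Cell r => ∀ v ∈ B, j v = i v), p j

/-- The conditional probability `p(i_A | i_B)`. -/
noncomputable def condProb (p : Cell r → ℝ) (A B : Finset V) (i : Cell r) : ℝ :=
  marg p (A ∪ B) i / marg p B i

/-- `A ⊥⊥ B | C`. -/
def CondIndep (p : Cell r → ℝ) (A B C : Finset V) : Prop :=
  ∀ i, marg p (A ∪ B ∪ C) i * marg p C i = marg p (A ∪ C) i * marg p (B ∪ C) i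

/-- Joint conditional independence given `C` of the (disjoint) sets in `S`. -/
def MutualCondIndep (p : Cell r → ℝ) (S : Finset (Finset V)) (C : Finset V) : Prop :=
  ∀ i, condProb p (S.biUnion id) C i = ∏ K ∈ S, condProb p K C i

/-- The multivariate regression Markov property. -/
def MRMarkov (G : ChainGraph V) (o : G.ConsistentOrder) (p : Cell r → ℝ) : Prop :=
  ∀ (T : G.Component) (A : Finset V), A ⊆ G.nodes T →
    (G.IsConn A → CondIndep p A (o.pre T \ G.parents A) (G.parents A)) ∧
    (¬ G.IsConn A → MutualCondIndep p (G.pieces A) (o.pre T))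

/-- The discrete multivariate regression chain graph model. -/
def modelMR (G : ChainGraph V) (o : G.ConsistentOrder) (r : V → ℕ) : Set (Cell r → ℝ) :=
  {p | IsPositiveDist p ∧ MRMarkov G o p}

variable [∀ v, NeZero (r v)]

/-- A cell with coordinates `i_s^*` on `s ⊆ A`, the first level on `A \ s`, and `i_B` on `B`
(`A` and `B` disjoint); the other coordinates are irrelevant where it is used. -/
def glue {A B : Finset V} (s : Finset V) (iA : StarCell r A) (iB : SubCell r B) : Cell r :=
  fun v => if hA : v ∈ A then (if v ∈ s then (iA ⟨v, hA⟩ : Fin (r v)) else 0)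
    else if hB : v ∈ B then iB ⟨v, hB⟩ else 0

/-- The multivariate logistic contrast `η^{(A)}(i_A^* | i_B)` of the conditional
distribution given `X_B = i_B`. -/
noncomputable def logisticContrast (p : Cell r → ℝ) (A B : Finset V)
    (iA : StarCell r A) (iB : SubCell r B) : ℝ :=
  ∑ s ∈ A.powerset, (-1 : ℝ) ^ (A \ s).card * Real.log (condProb p A B (glue s iA iB))

/-- Indices of the regression parameters `β^{(A)}_b(i_b)`: a chain component `T`, a nonempty
`A ⊆ T`, a set `b ⊆ pre(T)`, the coordinate `i_A^*` of the vector, and `i_b`. -/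
abbrev ParamIndex {G : ChainGraph V} (o : G.ConsistentOrder) (r : V → ℕ)
    [∀ v, NeZero (r v)] : Type _ :=
  Σ (T : G.Component) (A : {A : Finset V // A.Nonempty ∧ A ⊆ G.nodes T})
    (b : {b : Finset V // b ⊆ o.pre T}), StarCell r A.1 × SubCell r b.1

/-- `β` is the parameter of `p` in the saturated multivariate logistic regression model,
in the baseline coding. -/
def IsSaturatedParam {G : ChainGraph V} (o : G.ConsistentOrder) (p : Cell r → ℝ)
    (β : ParamIndex o r → ℝ) : Prop :=
  (∀ (T : G.Component) (A : {A : Finset V // A.Nonempty ∧ A ⊆ G.nodes T})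
      (iA : StarCell r A.1) (i : SubCell r (o.pre T)),
    logisticContrast p A.1 (o.pre T) iA i =
      ∑ b : {b : Finset V // b ∈ (o.pre T).powerset},
        β ⟨T, A, ⟨b.1, Finset.mem_powerset.1 b.2⟩, iA,
          fun v => i ⟨v.1, Finset.mem_powerset.1 b.2 v.2⟩⟩) ∧
  (∀ T A b iA ib, (∃ v, ib v = 0) → β ⟨T, A, b, iA, ib⟩ = 0)

/-- The parameters that the graph sets to zero. -/
def IsConstrained {G : ChainGraph V} {o : G.ConsistentOrder} (x : ParamIndex o r) : Prop :=
  (G.IsConn x.2.1.1 ∧ ¬ x.2.2.1.1 ⊆ G.parents x.2.1.1) ∨ ¬ G.IsConn x.2.1.1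

/-- The parameters that do not vanish identically by the baseline coding. -/
abbrev FreeIndex {G : ChainGraph V} (o : G.ConsistentOrder) (r : V → ℕ)
    [∀ v, NeZero (r v)] : Type _ :=
  {x : ParamIndex o r // ∀ v, x.2.2.2.2 v ≠ 0}

noncomputable instance FreeIndex.instFintype {G : ChainGraph V} (o : G.ConsistentOrder)
    (r : V → ℕ) [∀ v, NeZero (r v)] : Fintype (FreeIndex o r) := Fintype.ofFinite _

/-- The natural parameter space of the family of all strictly positive distributions:
one coordinate for every cell other than the reference cell `(0, …, 0)`. -/
abbrev NatParam {V : Type*} (r : V → ℕ) [∀ v, NeZero (r v)] : Type _ :=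
  {i : Cell r // i ≠ fun _ => 0} → ℝ

/-- The canonical statistic paired with the natural parameter: `θ_i`, and `0` at the reference. -/
noncomputable def natScore (θ : NatParam r) (i : Cell r) : ℝ :=
  if h : i ≠ fun _ => 0 then θ ⟨i, h⟩ else 0

/-- The member of the saturated (full, regular, minimal) exponential family with natural
parameter `θ`; its natural parameters are `θ_i = log (p i / p (0, …, 0))`. -/
noncomputable def expDist (θ : NatParam r) (i : Cell r) : ℝ :=
  Real.exp (natScore θ i - Real.log (∑ j, Real.exp (natScore θ j)))

/-- `S` is an embedded smooth submanifold of `E`: near each of its points, a smooth change of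
coordinates carries `S` to a fixed linear subspace. -/
def IsSmoothSubmanifold {E : Type*} [NormedAddCommGroup E] [NormedSpace ℝ E] (S : Set E) : Prop :=
  ∃ W : Submodule ℝ E, ∀ x ∈ S, ∃ φ : OpenPartialHomeomorph E E,
    x ∈ φ.source ∧ ContDiffOn ℝ ∞ φ φ.source ∧ ContDiffOn ℝ ∞ φ.symm φ.target ∧
      ∀ y ∈ φ.source, y ∈ S ↔ φ y ∈ W

/-- A curved exponential family in the saturated exponential family: its set of natural
parameters is a smooth submanifold of the natural parameter space. -/
def IsCurvedExponentialFamily (M : Set (Cell r → ℝ)) : Prop :=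
  ∃ Θ : Set (NatParam r), IsSmoothSubmanifold Θ ∧ M = expDist '' Θ

end Tables

/-
A positive table is determined by its multivariate logistic interactions: the highest-order
contrasts of the logarithms of all its marginals.  Suppose that `q` and `q'` have the same
interactions and, by induction, the same marginals over proper subsets of `C`.  The difference `d`
of their `C`-marginals then sums to zero over every nonempty set of variables of `C`, hence is
orthogonal to the difference `l` of their log `C`-marginals, which has no interaction of order `C`.
As `l` and `d` have the same sign, `d = 0`.  The same argument with `l = δq / q` and `d = δq` shows
that a tangent vector that fixes all interactions to first order is zero.

Applied to the conditional laws of the components `T` given `pre(T)`, this yields the conditional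
independences from the vanishing of interactions (compare `p(· | pre(T))` with its slices and with
the product of its marginals), and, by recursion along the order of the components, the injectivity
of the parameter map and of its derivative.  Sending a free parameter to the cell with the same
coordinates shows that there are no more of them than natural parameters, so the derivative is
invertible and the inverse function theorem applies.
-/

section Contrasts

open Function

variable {V : Type*} [DecidableEq V] {α : V → Type*} {R : Type*} [CommRing R]

/-- The iterated difference `∑_{D ⊆ A} (-1)^|D| f(c_D, i_{V \ D})` of `f` over the coordinates
in `A`, relative to the base point `c`. -/
def contrast (c : ∀ v, α v) (A : Finset V) : ((∀ v, α v) → R) →ₗ[R] ((∀ v, α v) → R) where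
  toFun f i := ∑ D ∈ A.powerset, (-1) ^ D.card * f (D.piecewise c i)
  map_add' f g := by
    ext i
    simp only [Pi.add_apply, mul_add, Finset.sum_add_distrib]
  map_smul' a f := by
    ext i
    simp only [Pi.smul_apply, smul_eq_mul, RingHom.id_apply, Finset.mul_sum, mul_left_comm]

variable {c : ∀ v, α v} {A : Finset V} {f : (∀ v, α v) → R} {i : ∀ v, α v}

theorem contrast_apply (c : ∀ v, α v) (A : Finset V) (f : (∀ v, α v) → R) (i : ∀ v, α v) :
    contrast c A f i = ∑ D ∈ A.powerset, (-1) ^ D.card * f (D.piecewise c i) := rfl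

theorem contrast_empty (c : ∀ v, α v) (f : (∀ v, α v) → R) : contrast c ∅ f = f := by
  ext i
  simp [contrast_apply]

theorem contrast_insert {a : V} (ha : a ∉ A) (c : ∀ v, α v) (f : (∀ v, α v) → R)
    (i : ∀ v, α v) :
    contrast c (insert a A) f i = contrast c A f i - contrast c A f (update i a (c a)) := by
  simp only [contrast_apply]
  rw [Finset.sum_powerset_insert ha, sub_eq_add_neg, ← Finset.sum_neg_distrib]
  congr 1
  refine Finset.sum_congr rfl fun D hD => ?_
  have haD : a ∉ D := fun h => ha (Finset.mem_powerset.1 hD h)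
  rw [Finset.card_insert_of_notMem haD, Finset.piecewise_insert,
    Finset.update_piecewise_of_notMem _ _ _ haD]
  ring

theorem dependsOn_contrast {S : Set V} (hf : DependsOn f S) (c : ∀ v, α v) (A : Finset V) :
    DependsOn (contrast c A f) S := by
  intro i j hij
  simp only [contrast_apply]
  refine Finset.sum_congr rfl fun D _ => congr_arg _ (hf fun v hv => ?_)
  simp only [Finset.piecewise, hij v hv]

theorem contrast_eq_zero_of_eq {v : V} (hv : v ∈ A) (hi : i v = c v) (f : (∀ v, α v) → R) :
    contrast c A f i = 0 := by
  rw [← Finset.insert_erase hv, contrast_insert (Finset.notMem_erase v A), ← hi, update_eq_self,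
    sub_self]

theorem contrast_eq_zero_of_dependsOn {S : Set V} (hf : DependsOn f S) {v : V} (hv : v ∈ A)
    (hvS : v ∉ S) (c : ∀ v, α v) : contrast c A f = 0 := by
  ext i
  have hupd : contrast c A f (update i v (c v)) = contrast c A f i :=
    dependsOn_contrast hf c A fun w hw => update_of_ne (ne_of_mem_of_not_mem hw hvS) _ _
  rw [← hupd, contrast_eq_zero_of_eq hv (update_self v (c v) i), Pi.zero_apply]

theorem contrast_comp_piecewise {B : Finset V} (h : Disjoint A B) (c : ∀ v, α v)
    (f : (∀ v, α v) → R) (k i : ∀ v, α v) :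
    contrast c A (fun j => f (B.piecewise k j)) i = contrast c A f (B.piecewise k i) := by
  simp only [contrast_apply]
  refine Finset.sum_congr rfl fun D hD => congr_arg _ (congr_arg f (funext fun v => ?_))
  have hDB : v ∈ D → v ∉ B := fun hv => Finset.disjoint_left.1 h (Finset.mem_powerset.1 hD hv)
  by_cases hv : v ∈ D <;> simp [Finset.piecewise, hv, hDB]

theorem sum_contrast (c : ∀ v, α v) (B : Finset V) (f : (∀ v, α v) → R) (i : ∀ v, α v) :
    ∑ b ∈ B.powerset, contrast c b f ((B \ b).piecewise c i) = f i := by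
  induction B using Finset.induction_on generalizing i with
  | empty =>
    rw [Finset.powerset_empty, Finset.sum_singleton, contrast_empty, Finset.sdiff_self,
      Finset.piecewise_empty]
  | insert a B ha ih =>
    rw [Finset.sum_powerset_insert ha, ← Finset.sum_add_distrib, ← ih i]
    refine Finset.sum_congr rfl fun b hb => ?_
    have hab : a ∉ b := fun h => ha (Finset.mem_powerset.1 hb h)
    rw [contrast_insert hab, Finset.insert_sdiff_of_notMem _ hab, Finset.piecewise_insert,
      Finset.insert_sdiff_insert, Finset.sdiff_insert_of_notMem ha, add_sub_cancel]

theorem contrast_eq_self (hf : ∀ j v, v ∈ A → j v = c v → f j = 0) (i : ∀ v, α v) :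
    contrast c A f i = f i := by
  rw [contrast_apply, Finset.sum_eq_single_of_mem ∅ (Finset.empty_mem_powerset A)]
  · simp
  · intro D hD hD0
    obtain ⟨v, hv⟩ := Finset.nonempty_iff_ne_empty.2 hD0
    rw [hf _ v (Finset.mem_powerset.1 hD hv) (Finset.piecewise_eq_of_mem _ _ _ hv), mul_zero]

theorem contrast_sum_of_dependsOn {ι : Type*} [Fintype ι] {S : ι → Finset V}
    (hS : Injective S) {γ : ι → (∀ v, α v) → R} (hdep : ∀ k, DependsOn (γ k) (S k))
    (hzero : ∀ k i v, v ∈ S k → i v = c v → γ k i = 0) (k : ι)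
    (hi : ∀ v, v ∉ S k → i v = c v) : contrast c (S k) (∑ k', γ k') i = γ k i := by
  rw [map_sum, Finset.sum_apply, Finset.sum_eq_single_of_mem k (Finset.mem_univ k),
    contrast_eq_self fun j v => hzero k j v]
  intro k' _ hk'
  by_cases hsub : S k ⊆ S k'
  · obtain ⟨v, hv', hv⟩ := Finset.not_subset.1 fun h => hk' (hS (h.antisymm hsub))
    refine Finset.sum_eq_zero fun D hD => ?_
    rw [hzero k' _ v hv', mul_zero]
    rw [Finset.piecewise_eq_of_notMem _ _ _ fun h => hv (Finset.mem_powerset.1 hD h), hi v hv]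
  · obtain ⟨v, hv, hv'⟩ := Finset.not_subset.1 hsub
    rw [contrast_eq_zero_of_dependsOn (hdep k') hv (mt Finset.mem_coe.1 hv'), Pi.zero_apply]

theorem dependsOn_of_contrast_piecewise_eq_zero {B : Finset V} {S T : Set V} (hf : DependsOn f S)
    (h : ∀ b ⊆ B, ¬ S ⊆ T ∪ ↑(B \ b) → ∀ i, contrast c b f ((B \ b).piecewise c i) = 0) :
    DependsOn f T := by
  intro i j hij
  rw [← sum_contrast c B f i, ← sum_contrast c B f j]
  refine Finset.sum_congr rfl fun b hb => ?_
  by_cases hST : S ⊆ T ∪ ↑(B \ b)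
  · refine dependsOn_contrast hf c b fun v hv => ?_
    by_cases hvb : v ∈ B \ b
    · rw [Finset.piecewise_eq_of_mem _ _ _ hvb, Finset.piecewise_eq_of_mem _ _ _ hvb]
    · rw [Finset.piecewise_eq_of_notMem _ _ _ hvb, Finset.piecewise_eq_of_notMem _ _ _ hvb]
      exact hij v ((hST hv).resolve_right hvb)
  · rw [h b (Finset.mem_powerset.1 hb) hST, h b (Finset.mem_powerset.1 hb) hST]

end Contrasts

section MarginalSums

open Function

variable {V : Type*} [DecidableEq V] {α : V → Type*} [∀ v, Fintype (α v)]

section CommSemiring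

variable {R : Type*} [CommSemiring R]

/-- The function obtained from `f` by summing out the coordinates in `s`, regarded again as a
function of all coordinates; the counting-measure analogue of `MeasureTheory.lmarginal`. -/
def marginalSum (s : Finset V) : ((∀ v, α v) → R) →ₗ[R] ((∀ v, α v) → R) where
  toFun f i := ∑ y : ∀ v : s, α v, f (updateFinset i s y)
  map_add' f g := by
    ext i
    simp only [Pi.add_apply, Finset.sum_add_distrib]
  map_smul' a f := by
    ext i
    simp only [Pi.smul_apply, smul_eq_mul, RingHom.id_apply, Finset.mul_sum]

theorem marginalSum_apply (s : Finset V) (f : (∀ v, α v) → R) (i : ∀ v, α v) :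
    marginalSum s f i = ∑ y : ∀ v : s, α v, f (updateFinset i s y) := rfl

theorem marginalSum_empty (f : (∀ v, α v) → R) : marginalSum ∅ f = f := by
  ext i
  simp [marginalSum_apply]

theorem marginalSum_union {s t : Finset V} (hst : Disjoint s t) (f : (∀ v, α v) → R) :
    marginalSum (s ∪ t) f = marginalSum s (marginalSum t f) := by
  ext i
  simp only [marginalSum_apply, updateFinset_updateFinset hst]
  rw [← (Equiv.piFinsetUnion α hst).sum_comp, Fintype.sum_prod_type]

theorem marginalSum_mul_left {s : Finset V} {S : Set V} {g : (∀ v, α v) → R}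
    (hg : DependsOn g S) (hS : Disjoint S s) (f : (∀ v, α v) → R) :
    marginalSum s (g * f) = g * marginalSum s f := by
  ext i
  simp only [marginalSum_apply, Pi.mul_apply, Finset.mul_sum]
  refine Finset.sum_congr rfl fun y _ => congr_arg (· * _) (hg fun v hv => ?_)
  simp [updateFinset, mt Finset.mem_coe.2 (Set.disjoint_left.1 hS hv)]

theorem marginalSum_comp_piecewise {s B : Finset V} (h : Disjoint s B) (f : (∀ v, α v) → R)
    (k i : ∀ v, α v) :
    marginalSum s (fun j => f (B.piecewise k j)) i = marginalSum s f (B.piecewise k i) := by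
  simp only [marginalSum_apply]
  refine Finset.sum_congr rfl fun y _ => congr_arg f (funext fun v => ?_)
  have hB : v ∈ s → v ∉ B := fun hv => Finset.disjoint_left.1 h hv
  by_cases hv : v ∈ s <;> simp [Finset.piecewise, updateFinset, hv, hB]

theorem dependsOn_marginalSum {S : Set V} {f : (∀ v, α v) → R} (hf : DependsOn f S)
    (s : Finset V) : DependsOn (marginalSum s f) (S \ s) := by
  intro i j hij
  refine Finset.sum_congr rfl fun y _ => hf fun v hv => ?_
  by_cases hvs : v ∈ s
  · simp [updateFinset, hvs]
  · simpa [updateFinset, hvs] using hij v ⟨hv, hvs⟩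

end CommSemiring

theorem marginalSum_pos [∀ v, Nonempty (α v)] {f : (∀ v, α v) → ℝ} (hf : ∀ i, 0 < f i)
    (s : Finset V) (i : ∀ v, α v) :
    0 < marginalSum s f i :=
  Finset.sum_pos (fun _ _ => hf _) Finset.univ_nonempty

end MarginalSums

section Interactions

open Function

variable {V : Type*} [DecidableEq V] {α : V → Type*} [∀ v, Fintype (α v)]

theorem marginalSum_mul_eq_zero_of_contrast_eq_zero {R : Type*} [CommRing R] {c : ∀ v, α v}
    {A : Finset V} {f g : (∀ v, α v) → R} (hf : contrast c A f = 0)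
    (hg : ∀ b ⊂ A, marginalSum (A \ b) g = 0) : marginalSum A (f * g) = 0 := by
  have hexp : f * g = ∑ b ∈ A.powerset,
      (fun j => contrast c b f ((A \ b).piecewise c j)) * g := by
    ext j
    simp only [Finset.sum_apply, Pi.mul_apply, ← Finset.sum_mul, sum_contrast]
  rw [hexp, map_sum]
  refine Finset.sum_eq_zero fun b hb => ?_
  rcases (Finset.mem_powerset.1 hb).eq_or_ssubset with rfl | hbA
  · simp only [hf, Pi.zero_apply]
    exact (congr_arg _ (zero_mul g)).trans (map_zero _)
  · have hdep : DependsOn (fun j => contrast c b f ((A \ b).piecewise c j))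
        ((A \ b : Finset V) : Set V)ᶜ := fun i j hij =>
      congr_arg _ ((A \ b).piecewise_congr (fun _ _ => rfl) fun v hv => hij v (by simpa using hv))
    rw [← Finset.union_sdiff_of_subset hbA.subset, marginalSum_union Finset.disjoint_sdiff,
      Finset.union_sdiff_of_subset hbA.subset, marginalSum_mul_left hdep disjoint_compl_left,
      hg b hbA, mul_zero, map_zero]

theorem marginalSum_sdiff_sdiff {R : Type*} [CommSemiring R] {A B C : Finset V} (hCB : C ⊆ B)
    (hBA : B ⊆ A) (f : (∀ v, α v) → R) :
    marginalSum (B \ C) (marginalSum (A \ B) f) = marginalSum (A \ C) f := by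
  rw [← marginalSum_union, Finset.union_comm, Finset.sdiff_union_sdiff_cancel hBA hCB]
  exact Finset.disjoint_sdiff.mono_left Finset.sdiff_subset

theorem eq_zero_of_contrast_eq_zero {R : Type*} [CommRing R] [LinearOrder R]
    [IsStrictOrderedRing R] {c : ∀ v, α v} {A : Finset V} {d : (∀ v, α v) → R}
    {l : Finset V → (∀ v, α v) → R} (hl : ∀ C ⊆ A, contrast c C (l C) = 0)
    (hpos : ∀ C ⊆ A, ∀ i, marginalSum (A \ C) d i ≠ 0 → 0 < l C i * marginalSum (A \ C) d i) :
    d = 0 := by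
  have hmarginal : ∀ C ⊆ A, marginalSum (A \ C) d = 0 := by
    intro C
    induction C using Finset.strongInduction with
    | H C ih =>
      intro hC
      have hsum : marginalSum C (l C * marginalSum (A \ C) d) = 0 :=
        marginalSum_mul_eq_zero_of_contrast_eq_zero (hl C hC) fun b hb => by
          rw [marginalSum_sdiff_sdiff hb.subset hC, ih b hb (hb.subset.trans hC)]
      ext i
      by_contra hi
      refine (Finset.sum_pos' (fun y _ => ?_) ⟨C.restrict i, Finset.mem_univ _, ?_⟩).ne'
        (congr_fun hsum i)
      · by_cases hj : marginalSum (A \ C) d (updateFinset i C y) = 0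
        · rw [Pi.mul_apply, hj, mul_zero]
        · exact (hpos C hC _ hj).le
      · rw [updateFinset_restrict]
        exact hpos C hC i hi
  simpa only [Finset.sdiff_self, marginalSum_empty] using hmarginal A subset_rfl

theorem sub_mul_log_sub_log_pos {a b : ℝ} (ha : 0 < a) (hb : 0 < b) (h : a ≠ b) :
    0 < (Real.log a - Real.log b) * (a - b) := by
  rcases lt_or_gt_of_ne h with hab | hab
  · exact mul_pos_of_neg_of_neg (sub_neg.2 (Real.log_lt_log ha hab)) (sub_neg.2 hab)
  · exact mul_pos (sub_pos.2 (Real.log_lt_log hb hab)) (sub_pos.2 hab)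

/-- The multivariate logistic interactions of a table `q` over `A`: for each `C ⊆ A`, the
highest-order contrast of the logarithm of the `C`-marginal of `q`. -/
noncomputable def logInteraction (c : ∀ v, α v) (A : Finset V) (q : (∀ v, α v) → ℝ)
    (C : Finset V) : (∀ v, α v) → ℝ :=
  contrast c C fun i => Real.log (marginalSum (A \ C) q i)

variable {c : ∀ v, α v} {A : Finset V} {q q' : (∀ v, α v) → ℝ}

theorem eq_of_logInteraction_eq (hq : ∀ i, 0 < q i) (hq' : ∀ i, 0 < q' i)
    (h : ∀ C ⊆ A, logInteraction c A q C = logInteraction c A q' C) : q = q' := by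
  have : ∀ v, Nonempty (α v) := fun v => ⟨c v⟩
  refine sub_eq_zero.1 (eq_zero_of_contrast_eq_zero (c := c) (A := A) (l := fun C =>
    (fun i => Real.log (marginalSum (A \ C) q i)) - fun i => Real.log (marginalSum (A \ C) q' i))
    (fun C hC => ?_) fun C _ i hi => ?_)
  · rw [map_sub, sub_eq_zero]
    exact h C hC
  · rw [map_sub] at hi ⊢
    exact sub_mul_log_sub_log_pos (marginalSum_pos hq _ _) (marginalSum_pos hq' _ _)
      (sub_ne_zero.1 hi)

theorem hasDerivAt_marginalSum {q : ℝ → (∀ v, α v) → ℝ} {q' : (∀ v, α v) → ℝ} {t₀ : ℝ}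
    (hq' : ∀ i, HasDerivAt (q · i) (q' i) t₀) (s : Finset V) (i : ∀ v, α v) :
    HasDerivAt (fun t => marginalSum s (q t) i) (marginalSum s q' i) t₀ :=
  HasDerivAt.fun_sum fun _ _ => hq' _

theorem hasDerivAt_logInteraction {q : ℝ → (∀ v, α v) → ℝ} {q' : (∀ v, α v) → ℝ} {t₀ : ℝ}
    (hq : ∀ i, 0 < q t₀ i) (hq' : ∀ i, HasDerivAt (q · i) (q' i) t₀) (c : ∀ v, α v)
    (A C : Finset V) (i : ∀ v, α v) :
    HasDerivAt (fun t => logInteraction c A (q t) C i)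
      (contrast c C (marginalSum (A \ C) q' / marginalSum (A \ C) (q t₀)) i) t₀ := by
  have : ∀ v, Nonempty (α v) := fun v => ⟨c v⟩
  exact HasDerivAt.fun_sum fun D _ =>
    ((hasDerivAt_marginalSum hq' _ _).log (marginalSum_pos hq _ _).ne').const_mul _

theorem eq_zero_of_hasDerivAt_logInteraction {q : ℝ → (∀ v, α v) → ℝ} {q' : (∀ v, α v) → ℝ}
    {t₀ : ℝ} (hq : ∀ i, 0 < q t₀ i) (hq' : ∀ i, HasDerivAt (q · i) (q' i) t₀)
    (h : ∀ C ⊆ A, ∀ i, HasDerivAt (fun t => logInteraction c A (q t) C i) 0 t₀) : q' = 0 := by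
  have : ∀ v, Nonempty (α v) := fun v => ⟨c v⟩
  refine eq_zero_of_contrast_eq_zero (c := c) (A := A)
    (l := fun C => marginalSum (A \ C) q' / marginalSum (A \ C) (q t₀))
    (fun C hC => funext fun i => (hasDerivAt_logInteraction hq hq' c A C i).unique (h C hC i))
    fun C _ i hi => ?_
  rw [Pi.div_apply, div_mul_eq_mul_div]
  exact div_pos (mul_self_pos.2 hi) (marginalSum_pos hq _ _)

theorem logInteraction_comp_piecewise {B C : Finset V} (hAB : Disjoint A B) (hC : C ⊆ A)
    (c : ∀ v, α v) (q : (∀ v, α v) → ℝ) (k i : ∀ v, α v) :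
    logInteraction c A (fun j => q (B.piecewise k j)) C i =
      logInteraction c A q C (B.piecewise k i) := by
  simp only [logInteraction, marginalSum_comp_piecewise (hAB.mono_left Finset.sdiff_subset)]
  exact contrast_comp_piecewise (hAB.mono_left hC) c
    (fun j => Real.log (marginalSum (A \ C) q j)) k i

theorem dependsOn_of_dependsOn_logInteraction [Finite V] {S : Set V} (hq : ∀ i, 0 < q i)
    (h : ∀ C ⊆ A, DependsOn (logInteraction c A q C) (C ∪ S)) : DependsOn q (A ∪ S) := by
  cases nonempty_fintype V
  intro x y hxy
  have hslice : (fun j => q (Aᶜ.piecewise x j)) = fun j => q (Aᶜ.piecewise y j) := by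
    refine eq_of_logInteraction_eq (c := c) (A := A) (fun _ => hq _) (fun _ => hq _)
      fun C hC => funext fun i => ?_
    simp only [logInteraction_comp_piecewise disjoint_compl_right hC]
    refine h C hC fun v hv => ?_
    by_cases hvA : v ∈ Aᶜ
    · simpa [hvA] using hxy v (by grind)
    · simp [hvA]
  have hx := congr_fun hslice x
  simp only [Finset.piecewise_same] at hx
  rw [hx]
  congr 1
  ext v
  by_cases hvA : v ∈ Aᶜ
  · rw [Finset.piecewise_eq_of_mem _ _ _ hvA]
  · rw [Finset.piecewise_eq_of_notMem _ _ _ hvA, hxy v (by simp_all)]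

theorem marginalSum_union_mul {R : Type*} [CommSemiring R] {A₁ A₂ D₁ D₂ : Finset V}
    (hA : Disjoint A₁ A₂) (h₁ : D₁ ⊆ A₁) (h₂ : D₂ ⊆ A₂) (f : (∀ v, α v) → R) :
    marginalSum (D₁ ∪ D₂) (marginalSum A₂ f * marginalSum A₁ f) =
      marginalSum (D₁ ∪ A₂) f * marginalSum (D₂ ∪ A₁) f := by
  have hdep₂ : DependsOn (marginalSum A₂ f) (Set.univ \ A₂) :=
    dependsOn_marginalSum (dependsOn_univ f) A₂
  have hdep₁ : DependsOn (marginalSum D₂ (marginalSum A₁ f)) (Set.univ \ A₁) :=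
    (dependsOn_marginalSum (dependsOn_marginalSum (dependsOn_univ f) A₁) D₂).mono Set.sdiff_subset
  rw [marginalSum_union (hA.mono h₁ h₂), marginalSum_union (hA.mono_left h₁),
    marginalSum_union (hA.symm.mono_left h₂),
    marginalSum_mul_left hdep₂ (Set.disjoint_sdiff_left.mono_right (Finset.coe_subset.2 h₂)),
    mul_comm, marginalSum_mul_left hdep₁
      (Set.disjoint_sdiff_left.mono_right (Finset.coe_subset.2 h₁)), mul_comm]

theorem logInteraction_mul_eq_zero {A₁ A₂ C : Finset V} (hA : Disjoint A₁ A₂) (hC : C ⊆ A₁ ∪ A₂)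
    (hC₁ : ¬ C ⊆ A₁) (hC₂ : ¬ C ⊆ A₂) (hq : ∀ i, 0 < q i) :
    logInteraction c (A₁ ∪ A₂) (marginalSum A₂ q * marginalSum A₁ q) C = 0 := by
  have : ∀ v, Nonempty (α v) := fun v => ⟨c v⟩
  obtain ⟨v₂, hv₂C, hv₂⟩ := Finset.not_subset.1 hC₁
  obtain ⟨v₁, hv₁C, hv₁⟩ := Finset.not_subset.1 hC₂
  have hv₂A : v₂ ∈ A₂ := (Finset.mem_union.1 (hC hv₂C)).resolve_left hv₂
  have hv₁A : v₁ ∈ A₁ := (Finset.mem_union.1 (hC hv₁C)).resolve_right hv₁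
  have hlog : (fun i => Real.log (marginalSum ((A₁ ∪ A₂) \ C)
      (marginalSum A₂ q * marginalSum A₁ q) i)) =
      (fun i => Real.log (marginalSum (A₁ \ C ∪ A₂) q i)) +
        fun i => Real.log (marginalSum (A₂ \ C ∪ A₁) q i) := by
    ext i
    rw [Finset.union_sdiff_distrib, marginalSum_union_mul hA Finset.sdiff_subset
      Finset.sdiff_subset, Pi.mul_apply, Real.log_mul (marginalSum_pos hq _ _).ne'
      (marginalSum_pos hq _ _).ne', Pi.add_apply]
  have hdep : ∀ s : Finset V,
      DependsOn (fun i => Real.log (marginalSum s q i)) (Set.univ \ s) := fun s i j hij =>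
    congr_arg Real.log (dependsOn_marginalSum (dependsOn_univ q) s hij)
  rw [logInteraction, hlog, map_add,
    contrast_eq_zero_of_dependsOn (hdep _) hv₂C (by simp [hv₂A]),
    contrast_eq_zero_of_dependsOn (hdep _) hv₁C (by simp [hv₁A]),
    add_zero]

theorem eq_mul_of_logInteraction_eq_zero {A₁ A₂ : Finset V} (hA : Disjoint A₁ A₂)
    (hq : ∀ i, 0 < q i) (hsum : marginalSum (A₁ ∪ A₂) q = 1)
    (h : ∀ C ⊆ A₁ ∪ A₂, ¬ C ⊆ A₁ → ¬ C ⊆ A₂ → logInteraction c (A₁ ∪ A₂) q C = 0) :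
    q = marginalSum A₂ q * marginalSum A₁ q := by
  have : ∀ v, Nonempty (α v) := fun v => ⟨c v⟩
  refine eq_of_logInteraction_eq (c := c) (A := A₁ ∪ A₂) hq
    (fun i => mul_pos (marginalSum_pos hq _ i) (marginalSum_pos hq _ i)) fun C hC => ?_
  by_cases hC₁ : C ⊆ A₁
  · rw [logInteraction, logInteraction, Finset.union_sdiff_distrib,
      Finset.sdiff_eq_self_of_disjoint (hA.symm.mono_right hC₁),
      marginalSum_union_mul hA Finset.sdiff_subset subset_rfl, Finset.union_comm A₂, hsum, mul_one]
  by_cases hC₂ : C ⊆ A₂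
  · rw [logInteraction, logInteraction, Finset.union_sdiff_distrib,
      Finset.sdiff_eq_self_of_disjoint (hA.mono_right hC₂),
      marginalSum_union_mul hA subset_rfl Finset.sdiff_subset, hsum, one_mul, Finset.union_comm A₁]
  · rw [h C hC hC₁ hC₂, logInteraction_mul_eq_zero hA hC hC₁ hC₂ hq]

end Interactions

theorem union_sdiff_union_of_disjoint {V : Type*} [DecidableEq V] {A B : Finset V}
    (hAB : Disjoint A B) (C : Finset V) : (A ∪ B) \ (C ∪ B) = A \ C := by
  ext v
  have hv : v ∈ A → v ∉ B := fun hA => Finset.disjoint_left.1 hAB hA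
  simp only [Finset.mem_sdiff, Finset.mem_union]
  tauto

section Cells

variable {V : Type*} [DecidableEq V] {r : V → ℕ} [∀ v, NeZero (r v)] {A B : Finset V}

/-- The reference cell `(0, …, 0)`, whose coordinates are the baseline levels. -/
abbrev baseCell : Cell r := fun _ => 0

theorem glue_of_mem_left {v : V} (hv : v ∈ A) (iA : StarCell r A) (iB : SubCell r B) :
    glue A iA iB v = iA ⟨v, hv⟩ := by
  rw [glue, dif_pos hv, if_pos hv]

theorem glue_of_mem_right {v : V} (hvA : v ∉ A) (hvB : v ∈ B) (iA : StarCell r A)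
    (iB : SubCell r B) : glue A iA iB v = iB ⟨v, hvB⟩ := by
  rw [glue, dif_neg hvA, dif_pos hvB]

theorem piecewise_baseCell_glue {D : Finset V} (hD : D ⊆ A) (iA : StarCell r A)
    (iB : SubCell r B) : D.piecewise baseCell (glue A iA iB) = glue (A \ D) iA iB := by
  ext v
  by_cases hvD : v ∈ D
  · simp [glue, hvD, hD hvD]
  · by_cases hvA : v ∈ A <;> simp [glue, hvD, hvA]

end Cells

section ConditionalProbabilities

variable {V : Type*} [Fintype V] [DecidableEq V] {r : V → ℕ} {p : Cell r → ℝ} {A B C : Finset V}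

theorem marg_eq_marginalSum (p : Cell r → ℝ) (B : Finset V) : marg p B = marginalSum Bᶜ p := by
  ext i
  have hupdate : ∀ j ∈ Finset.univ.filter fun j : Cell r => ∀ v ∈ B, j v = i v,
      Function.updateFinset i Bᶜ (Finset.restrict Bᶜ j) = j := fun j hj => by
    ext v
    by_cases hv : v ∈ B
    · simp [Function.updateFinset, hv, (Finset.mem_filter.1 hj).2 v hv]
    · simp [Function.updateFinset, hv]
  refine Finset.sum_nbij' (fun j => Finset.restrict Bᶜ j) (Function.updateFinset i Bᶜ)
    (fun _ _ => Finset.mem_univ _) (fun y _ => ?_) hupdate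
    (fun y _ => Function.restrict_updateFinset _ _) fun j hj => by rw [hupdate j hj]
  simp +contextual [Function.updateFinset]

theorem marginalSum_marg (p : Cell r → ℝ) (hCB : C ⊆ B) :
    marginalSum (B \ C) (marg p B) = marg p C := by
  simp only [marg_eq_marginalSum, Finset.compl_eq_univ_sdiff,
    marginalSum_sdiff_sdiff hCB (Finset.subset_univ B)]

theorem marg_univ (p : Cell r → ℝ) : marg p Finset.univ = p := by
  rw [marg_eq_marginalSum, Finset.compl_univ, marginalSum_empty]

theorem marg_empty (p : Cell r → ℝ) (i : Cell r) : marg p ∅ i = ∑ j, p j := by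
  simp [marg]

theorem marg_pos (hp : ∀ i, 0 < p i) (B : Finset V) (i : Cell r) : 0 < marg p B i :=
  Finset.sum_pos (fun j _ => hp j) ⟨i, by simp⟩

theorem dependsOn_marg (p : Cell r → ℝ) (B : Finset V) : DependsOn (marg p B) B := by
  rw [marg_eq_marginalSum]
  exact (dependsOn_marginalSum (dependsOn_univ p) Bᶜ).mono (by simp)

theorem hasDerivAt_marg {p : ℝ → Cell r → ℝ} {p' : Cell r → ℝ} {t₀ : ℝ}
    (hp' : ∀ i, HasDerivAt (p · i) (p' i) t₀) (B : Finset V) (i : Cell r) :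
    HasDerivAt (fun t => marg (p t) B i) (marg p' B i) t₀ :=
  HasDerivAt.fun_sum fun j _ => hp' j

theorem condProb_pos (hp : ∀ i, 0 < p i) (A B : Finset V) (i : Cell r) : 0 < condProb p A B i :=
  div_pos (marg_pos hp _ _) (marg_pos hp _ _)

theorem condProb_empty (hp : ∀ i, 0 < p i) (B : Finset V) : condProb p ∅ B = 1 := by
  ext i
  rw [condProb, Finset.empty_union, div_self (marg_pos hp _ _).ne', Pi.one_apply]

theorem condProb_mul_marg (hp : ∀ i, 0 < p i) (A B : Finset V) :
    condProb p A B * marg p B = marg p (A ∪ B) :=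
  funext fun i => div_mul_cancel₀ _ (marg_pos hp B i).ne'

theorem dependsOn_condProb (p : Cell r → ℝ) (A B : Finset V) :
    DependsOn (condProb p A B) (A ∪ B) := by
  intro i j h
  rw [condProb, condProb, dependsOn_marg p (A ∪ B) (by simpa using h),
    dependsOn_marg p B fun v hv => h v (Or.inr hv)]

theorem marginalSum_condProb (p : Cell r → ℝ) (hAB : Disjoint A B) (hCA : C ⊆ A) :
    marginalSum (A \ C) (condProb p A B) = condProb p C B := by
  have hinv : DependsOn (fun i => (marg p B i)⁻¹) (B : Set V) := fun i j h =>
    congr_arg (·⁻¹) (dependsOn_marg p B h)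
  have hmul : ∀ A, condProb p A B = (fun i => (marg p B i)⁻¹) * marg p (A ∪ B) := fun A =>
    funext fun i => div_eq_inv_mul _ _
  have hdisj : Disjoint (A \ C) B := hAB.mono_left Finset.sdiff_subset
  rw [hmul A, hmul C, marginalSum_mul_left hinv (by exact_mod_cast hdisj.symm),
    ← union_sdiff_union_of_disjoint hAB,
    marginalSum_marg p (Finset.union_subset_union_left hCA)]

theorem condIndep_iff_dependsOn (hp : ∀ i, 0 < p i) (hAB : Disjoint A B) (hCB : C ⊆ B) :
    CondIndep p A (B \ C) C ↔ DependsOn (condProb p A B) (A ∪ C) := by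
  rw [CondIndep, Finset.union_assoc, Finset.sdiff_union_of_subset hCB]
  constructor
  · intro h
    have heq : condProb p A B = condProb p A C := funext fun i => by
      rw [condProb, condProb, div_eq_div_iff (marg_pos hp _ _).ne' (marg_pos hp _ _).ne', h i]
    exact heq ▸ dependsOn_condProb p A C
  · intro h i
    have hset : B \ C = (A ∪ B) \ (A ∪ C) := by
      rw [← union_sdiff_union_of_disjoint hAB.symm, Finset.union_comm B, Finset.union_comm C]
    have hdisj : Disjoint (A ∪ C) (B \ C) :=
      Finset.disjoint_union_left.2 ⟨hAB.mono_right Finset.sdiff_subset, Finset.disjoint_sdiff⟩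
    have hmarg : marg p (A ∪ C) = condProb p A B * marg p C := by
      rw [← marginalSum_marg p (Finset.union_subset_union_right hCB), ← hset,
        ← condProb_mul_marg hp A B, marginalSum_mul_left h (by exact_mod_cast hdisj),
        marginalSum_marg p hCB]
    rw [hmarg, ← condProb_mul_marg hp A B, Pi.mul_apply, Pi.mul_apply]
    ring

variable [∀ v, NeZero (r v)]

/-- The contrast `η^{(A)}(i_A | i_B)`, as a function of an arbitrary cell `i`. -/
noncomputable def cellContrast (p : Cell r → ℝ) (A B : Finset V) : Cell r → ℝ :=
  contrast baseCell A fun i => Real.log (condProb p A B i)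

theorem dependsOn_cellContrast (p : Cell r → ℝ) (A B : Finset V) :
    DependsOn (cellContrast p A B) (A ∪ B) :=
  dependsOn_contrast (fun _ _ h => congr_arg Real.log (dependsOn_condProb p A B h)) _ _

theorem cellContrast_empty (p : Cell r → ℝ) (B : Finset V) : cellContrast p ∅ B = 0 := by
  ext i
  rw [cellContrast, contrast_empty, condProb, Finset.empty_union]
  by_cases h : marg p B i = 0 <;> simp [h]

theorem logInteraction_condProb (p : Cell r → ℝ) (hAB : Disjoint A B) (hCA : C ⊆ A) :
    logInteraction baseCell A (condProb p A B) C = cellContrast p C B := by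
  rw [logInteraction, marginalSum_condProb p hAB hCA, cellContrast]

theorem logisticContrast_eq_cellContrast (p : Cell r → ℝ) (iA : StarCell r A)
    (iB : SubCell r B) : logisticContrast p A B iA iB = cellContrast p A B (glue A iA iB) := by
  rw [cellContrast, contrast_apply]
  refine Finset.sum_nbij' (A \ ·) (A \ ·) (fun s _ => by simp) (fun s _ => by simp)
    (fun s hs => ?_) (fun s hs => ?_) fun s hs => ?_
  · exact Finset.sdiff_sdiff_eq_self (Finset.mem_powerset.1 hs)
  · exact Finset.sdiff_sdiff_eq_self (Finset.mem_powerset.1 hs)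
  · rw [piecewise_baseCell_glue Finset.sdiff_subset,
      Finset.sdiff_sdiff_eq_self (Finset.mem_powerset.1 hs)]

theorem condProb_union_of_cellContrast_eq_zero (hp : ∀ i, 0 < p i) {A₁ A₂ : Finset V}
    (hA : Disjoint A₁ A₂) (hB : Disjoint (A₁ ∪ A₂) B)
    (h : ∀ C ⊆ A₁ ∪ A₂, ¬ C ⊆ A₁ → ¬ C ⊆ A₂ → cellContrast p C B = 0) :
    condProb p (A₁ ∪ A₂) B = condProb p A₁ B * condProb p A₂ B := by
  have hmarginal := fun C (hC : C ⊆ A₁ ∪ A₂) => marginalSum_condProb p hB hC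
  have hsum : marginalSum (A₁ ∪ A₂) (condProb p (A₁ ∪ A₂) B) = 1 := by
    simpa only [Finset.sdiff_empty, condProb_empty hp] using hmarginal ∅ (Finset.empty_subset _)
  have h₁ := hmarginal A₁ Finset.subset_union_left
  have h₂ := hmarginal A₂ Finset.subset_union_right
  rw [Finset.union_sdiff_cancel_left hA] at h₁
  rw [Finset.union_sdiff_cancel_right hA] at h₂
  rw [← h₁, ← h₂]
  refine eq_mul_of_logInteraction_eq_zero (c := baseCell) hA (condProb_pos hp _ _) hsum
    fun C hC hC₁ hC₂ => ?_
  rw [logInteraction_condProb p hB hC, h C hC hC₁ hC₂]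

theorem mutualCondIndep_of_cellContrast_eq_zero (hp : ∀ i, 0 < p i) {S : Finset (Finset V)}
    (hS : (S : Set (Finset V)).PairwiseDisjoint id) (hSB : Disjoint (S.biUnion id) B)
    (h : ∀ C ⊆ S.biUnion id, (∀ K ∈ S, ¬ C ⊆ K) → cellContrast p C B = 0) :
    MutualCondIndep p S B := by
  induction S using Finset.induction_on with
  | empty =>
    intro i
    simp [condProb_empty hp]
  | insert K S hKS ih =>
    rw [Finset.biUnion_insert] at hSB h
    have hdisj : Disjoint K (S.biUnion id) := (Finset.disjoint_biUnion_right _ _ _).2 fun K' hK' =>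
      hS (by simp) (by simp [hK']) (ne_of_mem_of_not_mem hK' hKS).symm
    have hmutual : MutualCondIndep p S B := by
      refine ih (hS.subset (by simp)) (hSB.mono_left Finset.subset_union_right) fun C hC hCS => ?_
      by_cases hCK : C ⊆ K
      · rw [Finset.eq_empty_of_forall_notMem fun v hv =>
          Finset.disjoint_left.1 hdisj (hCK hv) (hC hv), cellContrast_empty]
      · exact h C (hC.trans Finset.subset_union_right)
          ((Finset.forall_mem_insert _ _ _).2 ⟨hCK, hCS⟩)
    have hunion := condProb_union_of_cellContrast_eq_zero hp hdisj hSB fun C hC hCK hCS =>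
      h C hC ((Finset.forall_mem_insert _ _ _).2 ⟨hCK, fun K' hK' hCK' =>
        hCS (hCK'.trans (Finset.subset_biUnion_of_mem id hK'))⟩)
    intro i
    rw [Finset.biUnion_insert, Finset.prod_insert hKS, ← hmutual i]
    exact congr_fun hunion i

theorem cellContrast_eq_zero_of_mutualCondIndep (hp : ∀ i, 0 < p i) {S : Finset (Finset V)}
    (hS : MutualCondIndep p S B) (hSB : Disjoint (S.biUnion id) B)
    (h : ∀ K ∈ S, ¬ S.biUnion id ⊆ K) : cellContrast p (S.biUnion id) B = 0 := by
  have hlog : (fun i => Real.log (condProb p (S.biUnion id) B i)) =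
      ∑ K ∈ S, fun i => Real.log (condProb p K B i) := funext fun i => by
    rw [hS i, Real.log_prod fun K _ => (condProb_pos hp K B i).ne', Finset.sum_apply]
  rw [cellContrast, hlog, map_sum]
  refine Finset.sum_eq_zero fun K hK => ?_
  obtain ⟨v, hv, hvK⟩ := Finset.not_subset.1 (h K hK)
  exact contrast_eq_zero_of_dependsOn
    (fun _ _ hij => congr_arg Real.log (dependsOn_condProb p K B hij)) hv
    (by simp [hvK, Finset.disjoint_left.1 hSB hv]) _

end ConditionalProbabilities

namespace ChainGraph

section Pieces

variable {V : Type*} {G : ChainGraph V} {A C K : Finset V} {u v w : V}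

theorem JoinedIn.mem_right (h : G.JoinedIn A v w) : w ∈ A := h.2.1

theorem JoinedIn.symm : G.JoinedIn A v w → G.JoinedIn A w v :=
  fun ⟨hv, hw, h⟩ => ⟨hw, hv, h.symm⟩

theorem JoinedIn.trans : G.JoinedIn A u v → G.JoinedIn A v w → G.JoinedIn A u w :=
  fun ⟨hu, _, huv⟩ ⟨_, hw, hvw⟩ => ⟨hu, hw, huv.trans hvw⟩

theorem IsConn.joinedIn (hC : G.IsConn C) (hCA : C ⊆ A) (hv : v ∈ C) (hw : w ∈ C) :
    G.JoinedIn A v w :=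
  ⟨hCA hv, hCA hw,
    (hC ⟨v, hv⟩ ⟨w, hw⟩).map (SimpleGraph.induceHomOfLE G.undir (by exact_mod_cast hCA)).toHom⟩

variable [DecidableEq V]

theorem mem_pieces : K ∈ G.pieces A ↔ ∃ v ∈ A, ∀ w, w ∈ K ↔ G.JoinedIn A v w := by
  classical
  rw [pieces, Finset.mem_image]
  refine exists_congr fun v => and_congr_right fun _ => ?_
  rw [eq_comm, Finset.ext_iff]
  refine forall_congr' fun w => ?_
  rw [Finset.mem_filter, and_iff_right_of_imp JoinedIn.mem_right, iff_comm]

theorem exists_mem_pieces_subset (hC : G.IsConn C) (hne : C.Nonempty) (hCA : C ⊆ A) :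
    ∃ K ∈ G.pieces A, C ⊆ K := by
  classical
  obtain ⟨v, hv⟩ := hne
  refine ⟨A.filter (G.JoinedIn A v), Finset.mem_image.2 ⟨v, hCA hv, by congr⟩, fun w hw => ?_⟩
  exact Finset.mem_filter.2 ⟨hCA hw, hC.joinedIn hCA hv hw⟩

theorem biUnion_pieces (A : Finset V) : (G.pieces A).biUnion id = A := by
  refine subset_antisymm (Finset.biUnion_subset.2 fun K hK w hw => ?_) fun v hv => ?_
  · obtain ⟨v, -, h⟩ := mem_pieces.1 hK
    exact ((h w).1 hw).mem_right
  · have hconn : G.IsConn {v} := fun x y => by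
      rw [Subtype.ext ((Finset.mem_singleton.1 x.2).trans (Finset.mem_singleton.1 y.2).symm)]
    obtain ⟨K, hK, hvK⟩ := exists_mem_pieces_subset hconn (Finset.singleton_nonempty v)
      (Finset.singleton_subset_iff.2 hv)
    exact Finset.mem_biUnion.2 ⟨K, hK, Finset.singleton_subset_iff.1 hvK⟩

theorem pairwiseDisjoint_pieces (A : Finset V) :
    (G.pieces A : Set (Finset V)).PairwiseDisjoint id := by
  intro K hK K' hK' hne
  obtain ⟨v, -, hv⟩ := mem_pieces.1 hK
  obtain ⟨v', -, hv'⟩ := mem_pieces.1 hK'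
  refine Finset.disjoint_left.2 fun w hw hw' => hne ?_
  have hvv' : G.JoinedIn A v v' := ((hv w).1 hw).trans ((hv' w).1 hw').symm
  ext u
  rw [hv, hv']
  exact ⟨hvv'.symm.trans, hvv'.trans⟩

theorem isConn_of_subset_mem_pieces (hK : K ∈ G.pieces A) (hAK : A ⊆ K) : G.IsConn A := by
  obtain ⟨a, -, ha⟩ := mem_pieces.1 hK
  intro x y
  obtain ⟨_, _, h⟩ := ((ha x).1 (hAK x.2)).symm.trans ((ha y).1 (hAK y.2))
  exact h

end Pieces

section Order

variable {V : Type*} [Fintype V] {G : ChainGraph V} {T : G.Component} {v w : V}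

theorem connectedComponentMk_ne_of_dir {V : Type*} {G : ChainGraph V} {v w : V} (h : G.dir w v) :
    G.undir.connectedComponentMk w ≠ G.undir.connectedComponentMk v := by
  intro heq
  have hreach := (SimpleGraph.ConnectedComponent.exact heq).symm
  rw [SimpleGraph.reachable_iff_reflTransGen] at hreach
  exact G.no_semidirected_cycle w v h (Relation.ReflTransGen.mono (fun _ _ => Or.inl) _ _ hreach)

theorem mem_nodes : v ∈ G.nodes T ↔ G.undir.connectedComponentMk v = T := by
  simp [nodes]

theorem ConsistentOrder.mem_pre {o : G.ConsistentOrder} :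
    v ∈ o.pre T ↔ o.prec T (G.undir.connectedComponentMk v) := by
  simp [pre]

theorem ConsistentOrder.disjoint_nodes_pre (o : G.ConsistentOrder) (T : G.Component) :
    Disjoint (G.nodes T) (o.pre T) :=
  Finset.disjoint_left.2 fun _ hv hv' =>
    o.irrefl T (by simpa only [mem_nodes.1 hv] using mem_pre.1 hv')

theorem ConsistentOrder.disjoint_of_subset (o : G.ConsistentOrder) {A B : Finset V}
    (hA : A ⊆ G.nodes T) (hB : B ⊆ o.pre T) : Disjoint A B :=
  (o.disjoint_nodes_pre T).mono hA hB

variable [DecidableEq V] {A C : Finset V}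

theorem mem_parents : w ∈ G.parents A ↔ w ∉ A ∧ ∃ v ∈ A, G.dir w v := by
  simp [parents]

theorem parents_subset_pre (o : G.ConsistentOrder) (hA : A ⊆ G.nodes T) :
    G.parents A ⊆ o.pre T := by
  intro w hw
  obtain ⟨-, v, hv, hwv⟩ := mem_parents.1 hw
  have hvT := mem_nodes.1 (hA hv)
  refine ConsistentOrder.mem_pre.2 ((o.total _ _ ?_).resolve_left fun h =>
    o.consistent _ _ h ⟨w, v, rfl, hvT, hwv⟩)
  exact hvT ▸ connectedComponentMk_ne_of_dir hwv

theorem parents_subset_parents (hA : A ⊆ G.nodes T) (hCA : C ⊆ A) :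
    G.parents C ⊆ G.parents A := by
  intro w hw
  obtain ⟨-, v, hv, hwv⟩ := mem_parents.1 hw
  refine mem_parents.2 ⟨fun hwA => connectedComponentMk_ne_of_dir hwv ?_, v, hCA hv, hwv⟩
  rw [mem_nodes.1 (hA hwA), mem_nodes.1 (hA (hCA hv))]

namespace ConsistentOrder

theorem exists_eq_nodes_union_pre (o : G.ConsistentOrder) {S : Finset V} (hne : S.Nonempty)
    (hS : ∀ v ∈ S, G.nodes (G.undir.connectedComponentMk v) ∪
      o.pre (G.undir.connectedComponentMk v) ⊆ S) : ∃ T, S = G.nodes T ∪ o.pre T := by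
  have : IsTrans G.Component o.prec := ⟨o.trans⟩
  have : Std.Irrefl o.prec := ⟨o.irrefl⟩
  have hwf : WellFounded o.prec := Finite.wellFounded_of_trans_of_irrefl o.prec
  obtain ⟨_, ⟨v, hv, rfl⟩, hmin⟩ :=
    hwf.has_min (G.undir.connectedComponentMk '' S) (hne.to_set.image _)
  refine ⟨_, subset_antisymm (fun w hw => ?_) (hS v hv)⟩
  rw [Finset.mem_union, mem_nodes, mem_pre]
  exact or_iff_not_imp_left.2 fun h => (o.total _ _ h).resolve_left (hmin _ ⟨w, hw, rfl⟩)

theorem induction_univ (o : G.ConsistentOrder) {P : Finset V → Prop} (empty : P ∅)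
    (union : ∀ T, P (o.pre T) → P (G.nodes T ∪ o.pre T)) : P Finset.univ := by
  suffices hclosed : ∀ S : Finset V, (∀ v ∈ S, G.nodes (G.undir.connectedComponentMk v) ∪
      o.pre (G.undir.connectedComponentMk v) ⊆ S) → P S from
    hclosed _ fun _ _ => Finset.subset_univ _
  intro S
  induction S using Finset.strongInduction with
  | H S ih =>
    intro hS
    obtain rfl | hne := S.eq_empty_or_nonempty
    · exact empty
    obtain ⟨T, rfl⟩ := o.exists_eq_nodes_union_pre hne hS
    refine union T (ih _ (Finset.subset_union_right.ssubset_of_ne fun heq => ?_)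
      fun v hv w hw => ?_)
    · obtain ⟨v, rfl⟩ := T.exists_rep
      have hv : v ∈ G.nodes (G.undir.connectedComponentMk v) := mem_nodes.2 rfl
      exact Finset.disjoint_left.1 (o.disjoint_nodes_pre _) hv (heq ▸ Finset.mem_union_left _ hv)
    · rw [mem_pre] at hv ⊢
      rw [Finset.mem_union, mem_nodes, mem_pre] at hw
      exact hw.elim (fun h => h ▸ hv) (o.trans _ _ _ hv)

end ConsistentOrder

end Order

end ChainGraph

section Parameters

variable {V : Type*} [Fintype V] [DecidableEq V] {G : ChainGraph V} {r : V → ℕ}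
  [∀ v, NeZero (r v)]

/-- The cell with the coordinates `i_A` and `i_b` of the index of a parameter, and the baseline
level elsewhere. -/
def ParamIndex.cell {V : Type*} [Fintype V] [DecidableEq V] {G : ChainGraph V} {r : V → ℕ}
    [∀ v, NeZero (r v)] {o : G.ConsistentOrder} (x : ParamIndex o r) : Cell r :=
  glue x.2.1.1 x.2.2.2.1 x.2.2.2.2

/-- The regression parameter of index `x` of the distribution `p`, obtained from the contrasts
`η^{(A)}` by Möbius inversion over the conditioning variables. -/
noncomputable def mrParam (o : G.ConsistentOrder) (p : Cell r → ℝ) (x : ParamIndex o r) : ℝ :=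
  contrast baseCell x.2.2.1.1 (cellContrast p x.2.1.1 (o.pre x.1)) x.cell

variable {o : G.ConsistentOrder} {p : Cell r → ℝ} {T : G.Component} {A : Finset V}

theorem ParamIndex.cell_of_mem_left (x : ParamIndex o r) {v : V} (hv : v ∈ x.2.1.1) :
    x.cell v = x.2.2.2.1 ⟨v, hv⟩ :=
  glue_of_mem_left hv _ _

theorem ParamIndex.cell_of_mem_right (x : ParamIndex o r) {v : V} (hv : v ∈ x.2.2.1.1) :
    x.cell v = x.2.2.2.2 ⟨v, hv⟩ :=
  glue_of_mem_right (Finset.disjoint_right.1 (o.disjoint_of_subset x.2.1.2.2 x.2.2.1.2) hv) hv _ _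

theorem mrParam_eq_zero_of_eq_zero {x : ParamIndex o r} {v : {v // v ∈ x.2.2.1.1}}
    (hv : x.2.2.2.2 v = 0) (p : Cell r → ℝ) : mrParam o p x = 0 :=
  contrast_eq_zero_of_eq v.2 ((x.cell_of_mem_right v.2).trans hv) _

theorem isSaturatedParam_mrParam (o : G.ConsistentOrder) (p : Cell r → ℝ) :
    IsSaturatedParam o p (mrParam o p) := by
  refine ⟨fun T A iA i => ?_, fun T A b iA ib ⟨v, hv⟩ => mrParam_eq_zero_of_eq_zero hv p⟩
  rw [logisticContrast_eq_cellContrast,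
    ← sum_contrast baseCell (o.pre T) (cellContrast p A.1 (o.pre T)), ← Finset.sum_coe_sort]
  refine Finset.sum_congr rfl fun b _ => congr_arg _ (funext fun v => ?_)
  have hb := Finset.mem_powerset.1 b.2
  have hv : v ∈ A.1 → v ∉ o.pre T := fun h =>
    Finset.disjoint_left.1 (o.disjoint_nodes_pre T) (A.2.2 h)
  by_cases hvA : v ∈ A.1
  · simp [Finset.piecewise, ParamIndex.cell, glue, hvA, hv hvA]
  · by_cases hvb : v ∈ b.1
    · simp [Finset.piecewise, ParamIndex.cell, glue, hvA, hvb, hb hvb]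
    · by_cases hvB : v ∈ o.pre T <;> simp [Finset.piecewise, ParamIndex.cell, glue, hvA, hvb, hvB]

theorem IsSaturatedParam.eq_mrParam {β : ParamIndex o r → ℝ} (hβ : IsSaturatedParam o p β) :
    β = mrParam o p := by
  funext ⟨T, A, b, iA, ib⟩
  let k : Cell r := ParamIndex.cell (o := o) ⟨T, A, b, iA, ib⟩
  let i : Cell r := A.1.piecewise baseCell k
  have hAb : Disjoint A.1 b.1 := o.disjoint_of_subset A.2.2 b.2
  have hkA : A.1.piecewise k i = k := by
    rw [Finset.piecewise_idem_right, Finset.piecewise_same]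
  let γ (b' : {b // b ∈ (o.pre T).powerset}) (j : Cell r) : ℝ :=
    β ⟨T, A, ⟨b'.1, Finset.mem_powerset.1 b'.2⟩, iA, fun v => j v⟩
  have hsum : ∑ b', γ b' = fun j => cellContrast p A.1 (o.pre T) (A.1.piecewise k j) := by
    ext j
    rw [Finset.sum_apply, ← hβ.1 T A iA fun v => j v, logisticContrast_eq_cellContrast]
    refine dependsOn_cellContrast p _ _ fun v hv => ?_
    by_cases hvA : v ∈ A.1
    · simp [ParamIndex.cell, glue, k, hvA]
    · simp [ParamIndex.cell, glue, k, hvA, Finset.mem_coe.1 (hv.resolve_left hvA)]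
  have hdep : ∀ b', DependsOn (γ b') b'.1 := fun b' j j' hj =>
    congr_arg (fun i => β ⟨T, A, _, iA, i⟩) (funext fun v => hj v v.2)
  have hzero : ∀ b' j v, v ∈ b'.1 → j v = 0 → γ b' j = 0 := fun b' j v hv hj =>
    hβ.2 _ _ _ _ _ ⟨⟨v, hv⟩, hj⟩
  have hiv : ∀ v, v ∉ b.1 → i v = 0 := fun v hv => by
    by_cases hvA : v ∈ A.1 <;> simp [i, k, ParamIndex.cell, glue, hvA, hv]
  have hγ : contrast baseCell b.1 (∑ b', γ b') i = γ ⟨b.1, Finset.mem_powerset.2 b.2⟩ i :=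
    contrast_sum_of_dependsOn Subtype.val_injective hdep hzero ⟨b.1, _⟩ hiv
  have hib : (fun v : {v // v ∈ b.1} => i v) = ib := funext fun v => by
    have hvA := Finset.disjoint_right.1 hAb v.2
    simp [i, k, ParamIndex.cell, glue, hvA]
  rw [hsum, contrast_comp_piecewise hAb.symm _ (cellContrast p A.1 (o.pre T)), hkA] at hγ
  exact (congr_arg (fun j => β ⟨T, A, b, iA, j⟩) hib).symm.trans hγ.symm

theorem contrast_cellContrast_eq_zero_or_eq_mrParam (o : G.ConsistentOrder)
    (A : {A : Finset V // A.Nonempty ∧ A ⊆ G.nodes T}) (b : {b : Finset V // b ⊆ o.pre T})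
    (i : Cell r) :
    (∀ p, contrast baseCell b.1 (cellContrast p A.1 (o.pre T))
      ((o.pre T \ b.1).piecewise baseCell i) = 0) ∨
    ∃ (iA : StarCell r A.1) (ib : SubCell r b.1), (∀ v, ib v ≠ 0) ∧
      ∀ p, contrast baseCell b.1 (cellContrast p A.1 (o.pre T))
        ((o.pre T \ b.1).piecewise baseCell i) = mrParam o p ⟨T, A, b, iA, ib⟩ := by
  have hdisj : ∀ v ∈ A.1, v ∉ o.pre T := fun v hv =>
    Finset.disjoint_left.1 (o.disjoint_nodes_pre T) (A.2.2 hv)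
  by_cases hA : ∀ v ∈ A.1, i v ≠ 0
  · by_cases hb : ∀ v ∈ b.1, i v ≠ 0
    · refine Or.inr ⟨fun v => ⟨i v, hA v v.2⟩, fun v => i v, fun v => hb v v.2, fun p => ?_⟩
      refine dependsOn_contrast (dependsOn_cellContrast p _ _) _ _ fun v hv => ?_
      by_cases hvA : v ∈ A.1
      · simp [Finset.piecewise, ParamIndex.cell, glue, hvA, hdisj v hvA]
      · have hvB : v ∈ o.pre T := hv.resolve_left hvA
        by_cases hvb : v ∈ b.1 <;>
          simp [Finset.piecewise, ParamIndex.cell, glue, hvA, hvb, hvB]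
    · push Not at hb
      obtain ⟨v, hv, hiv⟩ := hb
      exact Or.inl fun p => contrast_eq_zero_of_eq hv (by simp [Finset.piecewise, hv, hiv]) _
  · push Not at hA
    obtain ⟨v, hv, hiv⟩ := hA
    refine Or.inl fun p => Finset.sum_eq_zero fun D _ => mul_eq_zero_of_right _ ?_
    exact contrast_eq_zero_of_eq hv (by simp [Finset.piecewise, hdisj v hv, hiv]) _

end Parameters

section Markov

variable {V : Type*} [Fintype V] [DecidableEq V] {G : ChainGraph V} {r : V → ℕ}
  [∀ v, NeZero (r v)] {o : G.ConsistentOrder} {p : Cell r → ℝ}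

/-- The constraints that the multivariate regression Markov property puts on the contrasts
`η^{(A)}(i_A | i_{pre(T)})`: they depend on the parents of `A` only if `A` is connected, and
vanish if `A` is disconnected. -/
def IsContrastMarkov (o : G.ConsistentOrder) (p : Cell r → ℝ) : Prop :=
  ∀ (T : G.Component) (A : Finset V), A ⊆ G.nodes T →
    (G.IsConn A → DependsOn (cellContrast p A (o.pre T)) (A ∪ G.parents A)) ∧
    (¬ G.IsConn A → cellContrast p A (o.pre T) = 0)

theorem MRMarkov.isContrastMarkov (hp : ∀ i, 0 < p i) (h : MRMarkov G o p) :
    IsContrastMarkov o p := by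
  intro T A hA
  have hdisj : Disjoint A (o.pre T) := (o.disjoint_nodes_pre T).mono_left hA
  refine ⟨fun hconn => ?_, fun hconn => ?_⟩
  · have hdep := (condIndep_iff_dependsOn hp hdisj (ChainGraph.parents_subset_pre o hA)).1
      ((h T A hA).1 hconn)
    exact dependsOn_contrast (fun _ _ hij => congr_arg Real.log (hdep hij)) _ _
  · have hzero := cellContrast_eq_zero_of_mutualCondIndep hp ((h T A hA).2 hconn)
    rw [ChainGraph.biUnion_pieces] at hzero
    exact hzero hdisj fun K hK hAK => hconn (ChainGraph.isConn_of_subset_mem_pieces hK hAK)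

theorem IsContrastMarkov.mrMarkov (hp : ∀ i, 0 < p i) (h : IsContrastMarkov o p) :
    MRMarkov G o p := by
  intro T A hA
  have hdisj : Disjoint A (o.pre T) := (o.disjoint_nodes_pre T).mono_left hA
  refine ⟨fun _ => ?_, fun _ => ?_⟩
  · rw [condIndep_iff_dependsOn hp hdisj (ChainGraph.parents_subset_pre o hA)]
    refine dependsOn_of_dependsOn_logInteraction (c := baseCell) (condProb_pos hp _ _)
      fun C hCA => ?_
    rw [logInteraction_condProb p hdisj hCA]
    by_cases hC : G.IsConn C
    · exact ((h T C (hCA.trans hA)).1 hC).mono (Set.union_subset_union_right _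
        (by exact_mod_cast ChainGraph.parents_subset_parents hA hCA))
    · rw [(h T C (hCA.trans hA)).2 hC]
      exact fun _ _ _ => rfl
  · refine mutualCondIndep_of_cellContrast_eq_zero hp (ChainGraph.pairwiseDisjoint_pieces A) ?_ ?_
    all_goals rw [ChainGraph.biUnion_pieces]
    · exact hdisj
    intro C hCA hC
    obtain rfl | hne := C.eq_empty_or_nonempty
    · exact cellContrast_empty p _
    refine (h T C (hCA.trans hA)).2 fun hCconn => ?_
    obtain ⟨K, hK, hCK⟩ := ChainGraph.exists_mem_pieces_subset hCconn hne hCA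
    exact hC K hK hCK

theorem IsContrastMarkov.mrParam_eq_zero (h : IsContrastMarkov o p) {x : ParamIndex o r}
    (hx : IsConstrained x) : mrParam o p x = 0 := by
  obtain ⟨T, ⟨A, hne, hA⟩, ⟨b, hb⟩, iA, ib⟩ := x
  obtain ⟨hconn, hbA⟩ | hconn := hx
  · obtain ⟨v, hv, hvA⟩ := Finset.not_subset.1 hbA
    have hvA' := Finset.disjoint_right.1 (o.disjoint_of_subset hA hb) hv
    have hzero := contrast_eq_zero_of_dependsOn ((h T A hA).1 hconn) hv
      (fun hvmem => hvmem.elim hvA' hvA) baseCell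
    exact congr_fun hzero _
  · rw [mrParam, (h T A hA).2 hconn, map_zero, Pi.zero_apply]

theorem isContrastMarkov_of_mrParam_eq_zero
    (h : ∀ x : FreeIndex o r, IsConstrained x.1 → mrParam o p x.1 = 0) :
    IsContrastMarkov o p := by
  intro T A hA
  obtain rfl | hne := A.eq_empty_or_nonempty
  · rw [cellContrast_empty]
    exact ⟨fun _ _ _ _ => rfl, fun _ => rfl⟩
  have hzero : ∀ b ⊆ o.pre T, (G.IsConn A → ¬ b ⊆ G.parents A) → ∀ i,
      contrast baseCell b (cellContrast p A (o.pre T))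
        ((o.pre T \ b).piecewise baseCell i) = 0 := fun b hb hbA i => by
    obtain h₀ | ⟨iA, ib, hib, hmr⟩ :=
      contrast_cellContrast_eq_zero_or_eq_mrParam o ⟨A, hne, hA⟩ ⟨b, hb⟩ i
    · exact h₀ p
    · refine (hmr p).trans (h ⟨⟨T, ⟨A, hne, hA⟩, ⟨b, hb⟩, iA, ib⟩, hib⟩ ?_)
      by_cases hconn : G.IsConn A
      · exact Or.inl ⟨hconn, hbA hconn⟩
      · exact Or.inr hconn
  refine ⟨fun _ => ?_, fun hconn => funext fun i => ?_⟩
  · refine dependsOn_of_contrast_piecewise_eq_zero (dependsOn_cellContrast p _ _)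
      fun b hb hbA => hzero b hb fun _ hsub => hbA ?_
    rintro v (hv | hv)
    · exact Or.inl (Or.inl hv)
    · by_cases hvb : v ∈ b
      · exact Or.inl (Or.inr (hsub hvb))
      · exact Or.inr (Finset.mem_sdiff.2 ⟨hv, hvb⟩)
  · rw [← sum_contrast baseCell (o.pre T) (cellContrast p A (o.pre T)) i]
    exact Finset.sum_eq_zero fun b hb =>
      hzero b (Finset.mem_powerset.1 hb) (fun h => absurd h hconn) i

theorem mrMarkov_iff_mrParam_eq_zero (hp : ∀ i, 0 < p i) :
    MRMarkov G o p ↔ ∀ x : FreeIndex o r, IsConstrained x.1 → mrParam o p x.1 = 0 :=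
  ⟨fun h _ hx => (h.isContrastMarkov hp).mrParam_eq_zero hx,
    fun h => (isContrastMarkov_of_mrParam_eq_zero h).mrMarkov hp⟩

end Markov

section Recovery

variable {V : Type*} [Fintype V] [DecidableEq V] {G : ChainGraph V} {r : V → ℕ}
  [∀ v, NeZero (r v)] {o : G.ConsistentOrder}

theorem exists_cellContrast_eq_sum_mrParam (o : G.ConsistentOrder) {T : G.Component}
    {C : Finset V} (hC : C ⊆ G.nodes T) (i : Cell r) : ∃ a : FreeIndex o r → ℝ,
      ∀ p, cellContrast p C (o.pre T) i = ∑ x, a x * mrParam o p x.1 := by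
  classical
  obtain rfl | hne := C.eq_empty_or_nonempty
  · exact ⟨0, fun p => by simp [cellContrast_empty]⟩
  have hterm : ∀ b ⊆ o.pre T, ∃ a : FreeIndex o r → ℝ, ∀ p,
      contrast baseCell b (cellContrast p C (o.pre T)) ((o.pre T \ b).piecewise baseCell i) =
        ∑ x, a x * mrParam o p x.1 := fun b hb => by
    obtain h₀ | ⟨iA, ib, hib, hmr⟩ :=
      contrast_cellContrast_eq_zero_or_eq_mrParam o ⟨C, hne, hC⟩ ⟨b, hb⟩ i
    · exact ⟨0, fun p => (h₀ p).trans (by simp)⟩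
    · let x : FreeIndex o r := ⟨⟨T, ⟨C, hne, hC⟩, ⟨b, hb⟩, iA, ib⟩, hib⟩
      refine ⟨Pi.single x 1, fun p => (hmr p).trans ?_⟩
      rw [Fintype.sum_eq_single x fun y hy => by simp [hy], Pi.single_eq_same, one_mul]
  choose! a ha using hterm
  refine ⟨∑ b ∈ (o.pre T).powerset, a b, fun p => ?_⟩
  rw [← sum_contrast baseCell (o.pre T) (cellContrast p C (o.pre T)) i]
  simp only [Finset.sum_apply, Finset.sum_mul]
  rw [Finset.sum_comm]
  exact Finset.sum_congr rfl fun b hb => ha b (Finset.mem_powerset.1 hb) p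

theorem eq_of_mrParam_eq {p p' : Cell r → ℝ} (hp : IsPositiveDist p) (hp' : IsPositiveDist p')
    (h : ∀ x : FreeIndex o r, mrParam o p x.1 = mrParam o p' x.1) : p = p' := by
  have hcond : ∀ T : G.Component,
      condProb p (G.nodes T) (o.pre T) = condProb p' (G.nodes T) (o.pre T) := fun T => by
    refine eq_of_logInteraction_eq (c := baseCell) (A := G.nodes T) (condProb_pos hp.1 _ _)
      (condProb_pos hp'.1 _ _) fun C hC => funext fun i => ?_
    obtain ⟨a, ha⟩ := exists_cellContrast_eq_sum_mrParam o hC i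
    simp only [logInteraction_condProb _ (o.disjoint_nodes_pre T) hC, ha, h]
  have hmarg : marg p Finset.univ = marg p' Finset.univ := by
    refine o.induction_univ (P := fun S => marg p S = marg p' S) (funext fun i => ?_) fun T ih => ?_
    · rw [marg_empty, marg_empty, hp.2, hp'.2]
    · rw [← condProb_mul_marg hp.1, ← condProb_mul_marg hp'.1, hcond T, ih]
  simpa only [marg_univ] using hmarg

theorem eq_zero_of_hasDerivAt_mrParam {p : ℝ → Cell r → ℝ} {p' : Cell r → ℝ} {t₀ : ℝ}
    (hp : ∀ t, IsPositiveDist (p t)) (hp' : ∀ i, HasDerivAt (p · i) (p' i) t₀)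
    (h : ∀ x : FreeIndex o r, HasDerivAt (fun t => mrParam o (p t) x.1) 0 t₀) : p' = 0 := by
  have hcond : ∀ (T : G.Component) (i : Cell r),
      HasDerivAt (fun t => condProb (p t) (G.nodes T) (o.pre T) i) 0 t₀ := fun T i => by
    have hdiff : ∀ i, HasDerivAt (fun t => condProb (p t) (G.nodes T) (o.pre T) i) _ t₀ :=
      fun i => (hasDerivAt_marg hp' _ i).fun_div (hasDerivAt_marg hp' _ i)
        (marg_pos (hp t₀).1 _ i).ne'
    refine (hdiff i).congr_deriv <| congr_fun (eq_zero_of_hasDerivAt_logInteraction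
      (c := baseCell) (A := G.nodes T) (condProb_pos (hp t₀).1 _ _) hdiff fun C hC j => ?_) i
    obtain ⟨a, ha⟩ := exists_cellContrast_eq_sum_mrParam o hC j
    simp only [logInteraction_condProb _ (o.disjoint_nodes_pre T) hC, ha]
    exact (HasDerivAt.fun_sum fun x _ => (h x).const_mul (a x)).congr_deriv (by simp)
  have hmarg : ∀ i, HasDerivAt (fun t => marg (p t) Finset.univ i) 0 t₀ := by
    refine o.induction_univ (P := fun S => ∀ i, HasDerivAt (fun t => marg (p t) S i) 0 t₀)
      (fun i => ?_) fun T ih i => ?_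
    · simpa only [marg_empty, (hp _).2] using hasDerivAt_const t₀ (1 : ℝ)
    · simp only [← condProb_mul_marg (hp _).1]
      exact ((hcond T i).mul (ih i)).congr_deriv (by simp)
  funext i
  simpa only [marg_univ, Pi.zero_apply] using (hasDerivAt_marg hp' Finset.univ i).unique (hmarg i)

end Recovery

section ExponentialFamily

variable {V : Type*} [Fintype V] {r : V → ℕ} [∀ v, NeZero (r v)]

theorem natScore_coe (θ : NatParam r) (i : {i : Cell r // i ≠ fun _ => 0}) :
    natScore θ i.1 = θ i :=
  dif_pos i.2

theorem natScore_baseCell (θ : NatParam r) : natScore θ baseCell = 0 :=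
  dif_neg (not_not.2 rfl)

theorem natScore_add_smul (θ h : NatParam r) (t : ℝ) (i : Cell r) :
    natScore (θ + t • h) i = natScore θ i + t * natScore h i := by
  by_cases hi : i ≠ fun _ => 0 <;> simp [natScore, hi]

variable [DecidableEq V]

theorem contDiff_natScore (i : Cell r) : ContDiff ℝ ∞ fun θ : NatParam r => natScore θ i := by
  obtain rfl | hi := eq_or_ne i baseCell
  · simpa only [natScore_baseCell] using contDiff_const
  · simpa only [natScore_coe _ ⟨i, hi⟩] using contDiff_apply ℝ ℝ _

theorem sum_exp_natScore_pos (θ : NatParam r) : 0 < ∑ j, Real.exp (natScore θ j) :=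
  Finset.sum_pos (fun _ _ => Real.exp_pos _) Finset.univ_nonempty

theorem isPositiveDist_expDist (θ : NatParam r) : IsPositiveDist (expDist θ) := by
  refine ⟨fun i => Real.exp_pos _, ?_⟩
  simp only [expDist, Real.exp_sub, Real.exp_log (sum_exp_natScore_pos θ)]
  rw [← Finset.sum_div, div_self (sum_exp_natScore_pos θ).ne']

theorem log_expDist_sub_log_expDist (θ : NatParam r) (i : Cell r) :
    Real.log (expDist θ i) - Real.log (expDist θ baseCell) = natScore θ i := by
  rw [expDist, expDist, Real.log_exp, Real.log_exp, natScore_baseCell]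
  ring

theorem expDist_injective : Function.Injective (expDist (r := r)) := by
  intro θ θ' h
  funext i
  rw [← natScore_coe θ, ← natScore_coe θ', ← log_expDist_sub_log_expDist,
    ← log_expDist_sub_log_expDist, h]

theorem range_expDist : Set.range (expDist (r := r)) = {p | IsPositiveDist p} := by
  refine Set.Subset.antisymm (Set.range_subset_iff.2 isPositiveDist_expDist) fun p hp => ?_
  let θ : NatParam r := fun i => Real.log (p i.1) - Real.log (p baseCell)
  have hscore : ∀ i, natScore θ i = Real.log (p i) - Real.log (p baseCell) := fun i => by
    obtain rfl | hi := eq_or_ne i baseCell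
    · rw [natScore_baseCell, sub_self]
    · exact natScore_coe θ ⟨i, hi⟩
  have hsum : ∑ j, Real.exp (natScore θ j) = (p baseCell)⁻¹ := by
    simp only [hscore, Real.exp_sub, Real.exp_log (hp.1 _)]
    rw [← Finset.sum_div, hp.2, one_div]
  refine ⟨θ, funext fun i => ?_⟩
  rw [expDist, hsum, hscore, Real.log_inv, sub_neg_eq_add, sub_add_cancel, Real.exp_log (hp.1 i)]

theorem contDiff_expDist (i : Cell r) : ContDiff ℝ ∞ fun θ : NatParam r => expDist θ i :=
  ((contDiff_natScore i).sub ((ContDiff.sum fun j _ => (contDiff_natScore j).exp).log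
    fun θ => (sum_exp_natScore_pos θ).ne')).exp

end ExponentialFamily

section ParameterMap

variable {V : Type*} [Fintype V] [DecidableEq V] {G : ChainGraph V} {r : V → ℕ}
  [∀ v, NeZero (r v)]

/-- The map from the natural parameters `θ` of a strictly positive distribution to its regression
parameters `β^{(A)}_b(i_A, i_b)` with all levels of `i_A` and `i_b` different from the baseline. -/
noncomputable def paramMap (o : G.ConsistentOrder) (θ : NatParam r) (x : FreeIndex o r) : ℝ :=
  mrParam o (expDist θ) x.1

variable (o : G.ConsistentOrder)

theorem contDiff_paramMap : ContDiff ℝ ∞ (paramMap o (r := r)) := by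
  have hmarg : ∀ (B : Finset V) (i : Cell r),
      ContDiff ℝ ∞ fun θ : NatParam r => marg (expDist θ) B i :=
    fun B i => ContDiff.sum fun j _ => contDiff_expDist j
  have hlog : ∀ (A B : Finset V) (i : Cell r),
      ContDiff ℝ ∞ fun θ : NatParam r => Real.log (condProb (expDist θ) A B i) := fun A B i =>
    ((hmarg _ i).div (hmarg _ i) fun θ => (marg_pos (isPositiveDist_expDist θ).1 _ _).ne').log
      fun θ => (condProb_pos (isPositiveDist_expDist θ).1 _ _ _).ne'
  exact contDiff_pi.2 fun _ => ContDiff.sum fun _ _ => contDiff_const.mul <|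
    ContDiff.sum fun _ _ => contDiff_const.mul <| hlog _ _ _

theorem paramMap_injective : Function.Injective (paramMap o (r := r)) := fun θ θ' h =>
  expDist_injective <| eq_of_mrParam_eq (isPositiveDist_expDist θ) (isPositiveDist_expDist θ')
    (congr_fun h)

theorem fderiv_paramMap_injective (θ : NatParam r) :
    Function.Injective (fderiv ℝ (paramMap o) θ) := by
  refine (injective_iff_map_eq_zero _).2 fun h hh => ?_
  have hparam : HasDerivAt (fun t : ℝ => paramMap o (θ + t • h)) 0 0 :=
    hh ▸ ((contDiff_paramMap o).differentiable (by simp) θ).hasFDerivAt.hasLineDerivAt h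
  have hdist : ∀ i, HasDerivAt (fun t : ℝ => expDist (θ + t • h) i)
      (fderiv ℝ (fun θ : NatParam r => expDist θ i) θ h) 0 := fun i =>
    ((contDiff_expDist i).differentiable (by simp) θ).hasFDerivAt.hasLineDerivAt h
  have hzero := eq_zero_of_hasDerivAt_mrParam (o := o)
    (fun t : ℝ => isPositiveDist_expDist (θ + t • h)) hdist (hasDerivAt_pi.1 hparam)
  have hlog : ∀ i, HasDerivAt (fun t : ℝ => Real.log (expDist (θ + t • h) i)) 0 0 := fun i =>
    ((hdist i).log ((isPositiveDist_expDist _).1 i).ne').congr_deriv <|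
      (congr_arg (· / _) (congr_fun hzero i)).trans (zero_div _)
  have hscore : ∀ i, HasDerivAt (fun t : ℝ => natScore (θ + t • h) i) 0 0 := fun i => by
    simpa only [log_expDist_sub_log_expDist, sub_zero] using (hlog i).fun_sub (hlog baseCell)
  funext i
  have hline := hscore i
  simp only [natScore_add_smul] at hline
  exact (natScore_coe h i).symm.trans
    (((hasDerivAt_mul_const _).const_add _).unique hline)

end ParameterMap

section Dimension

variable {V : Type*} [Fintype V] [DecidableEq V] {G : ChainGraph V} {r : V → ℕ}
  [∀ v, NeZero (r v)] {o : G.ConsistentOrder}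

theorem FreeIndex.cell_ne_zero_iff (x : FreeIndex o r) (v : V) :
    x.1.cell v ≠ 0 ↔ v ∈ x.1.2.1.1 ∨ v ∈ x.1.2.2.1.1 := by
  by_cases hA : v ∈ x.1.2.1.1
  · simp only [hA, x.1.cell_of_mem_left hA, (x.1.2.2.2.1 _).2, ne_eq, not_false_eq_true, true_or]
  · by_cases hb : v ∈ x.1.2.2.1.1
    · simp only [hb, x.1.cell_of_mem_right hb, x.2, ne_eq, not_false_eq_true, or_true]
    · simp [ParamIndex.cell, glue, hA, hb]

theorem FreeIndex.component_eq_or_prec {x y : FreeIndex o r} (h : x.1.cell = y.1.cell) :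
    x.1.1 = y.1.1 ∨ o.prec y.1.1 x.1.1 := by
  obtain ⟨v, hv⟩ := x.1.2.1.2.1
  have hvT := ChainGraph.mem_nodes.1 (x.1.2.1.2.2 hv)
  have hvx := (x.cell_ne_zero_iff v).2 (Or.inl hv)
  rw [h, y.cell_ne_zero_iff] at hvx
  obtain hvy | hvy := hvx
  · exact Or.inl (hvT ▸ ChainGraph.mem_nodes.1 (y.1.2.1.2.2 hvy))
  · exact Or.inr (hvT ▸ ChainGraph.ConsistentOrder.mem_pre.1 (y.1.2.2.1.2 hvy))

theorem FreeIndex.component_eq_of_cell_eq {x y : FreeIndex o r} (h : x.1.cell = y.1.cell) :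
    x.1.1 = y.1.1 :=
  (component_eq_or_prec h).resolve_right fun hyx =>
    (component_eq_or_prec h.symm).elim (fun he => o.irrefl _ (he ▸ hyx))
      fun hxy => o.irrefl _ (o.trans _ _ _ hyx hxy)

theorem FreeIndex.mem_left_iff (x : FreeIndex o r) (v : V) :
    v ∈ x.1.2.1.1 ↔ x.1.cell v ≠ 0 ∧ v ∈ G.nodes x.1.1 := by
  rw [x.cell_ne_zero_iff]
  have hdisj : v ∈ G.nodes x.1.1 → v ∉ o.pre x.1.1 := fun hv =>
    Finset.disjoint_left.1 (o.disjoint_nodes_pre _) hv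
  exact ⟨fun hv => ⟨Or.inl hv, x.1.2.1.2.2 hv⟩,
    fun hv => hv.1.resolve_right fun hvb => hdisj hv.2 (x.1.2.2.1.2 hvb)⟩

theorem FreeIndex.mem_right_iff (x : FreeIndex o r) (v : V) :
    v ∈ x.1.2.2.1.1 ↔ x.1.cell v ≠ 0 ∧ v ∈ o.pre x.1.1 := by
  rw [x.cell_ne_zero_iff]
  have hdisj : v ∈ G.nodes x.1.1 → v ∉ o.pre x.1.1 := fun hv =>
    Finset.disjoint_left.1 (o.disjoint_nodes_pre _) hv
  exact ⟨fun hv => ⟨Or.inr hv, x.1.2.2.1.2 hv⟩,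
    fun hv => hv.1.resolve_left fun hvA => hdisj (x.1.2.1.2.2 hvA) hv.2⟩

theorem ParamIndex.eq_of_cell_eq {x y : ParamIndex o r} (hT : x.1 = y.1)
    (hA : x.2.1.1 = y.2.1.1) (hb : x.2.2.1.1 = y.2.2.1.1) (h : x.cell = y.cell) : x = y := by
  obtain ⟨T, ⟨A, hne, hAT⟩, ⟨b, hbT⟩, iA, ib⟩ := x
  obtain ⟨T', ⟨A', _⟩, ⟨b', _⟩, iA', ib'⟩ := y
  dsimp only at hT hA hb
  subst hT hA hb
  have hglue : ∀ v, glue A iA ib v = glue A iA' ib' v := congr_fun h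
  have hiA : iA = iA' := funext fun v => Subtype.ext <| by
    rw [← glue_of_mem_left v.2 iA ib, ← glue_of_mem_left v.2 iA' ib', hglue]
  have hib : ib = ib' := funext fun v => by
    have hv := Finset.disjoint_right.1 (o.disjoint_of_subset hAT hbT) v.2
    rw [← glue_of_mem_right hv v.2 iA ib, ← glue_of_mem_right hv v.2 iA' ib', hglue]
  rw [hiA, hib]

theorem FreeIndex.cell_injective (o : G.ConsistentOrder) :
    Function.Injective fun x : FreeIndex o r => x.1.cell := by
  intro x y h
  change x.1.cell = y.1.cell at h
  have hT := component_eq_of_cell_eq h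
  refine Subtype.ext (ParamIndex.eq_of_cell_eq hT ?_ ?_ h)
  · ext v
    rw [x.mem_left_iff, y.mem_left_iff, h, hT]
  · ext v
    rw [x.mem_right_iff, y.mem_right_iff, h, hT]

end Dimension

theorem finrank_natParam_eq {V : Type*} [Fintype V] {G : ChainGraph V} {r : V → ℕ}
    [∀ v, NeZero (r v)] (o : G.ConsistentOrder) :
    Module.finrank ℝ (NatParam r) = Module.finrank ℝ (FreeIndex o r → ℝ) := by
  classical
  refine le_antisymm (LinearMap.finrank_le_finrank_of_injective
    (f := (fderiv ℝ (paramMap o (r := r)) 0).toLinearMap) (fderiv_paramMap_injective o 0)) ?_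
  have hcell : ∀ x : FreeIndex o r, x.1.cell ≠ fun _ => 0 := fun x h =>
    have ⟨v, hv⟩ := x.1.2.1.2.1
    (x.cell_ne_zero_iff v).2 (Or.inl hv) (congr_fun h v)
  rw [Module.finrank_fintype_fun_eq_card, Module.finrank_fintype_fun_eq_card]
  exact Fintype.card_le_of_injective (fun x => ⟨x.1.cell, hcell x⟩) fun x y h =>
    FreeIndex.cell_injective o (congr_arg Subtype.val h)

section Diffeomorphisms

variable {E F : Type*} [NormedAddCommGroup E] [NormedSpace ℝ E] [NormedAddCommGroup F]
  [NormedSpace ℝ F]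

theorem exists_openPartialHomeomorph_of_contDiff [CompleteSpace E] {f : E → F} {f' : E → E ≃L[ℝ] F}
    {n : WithTop ℕ∞} (hn : n ≠ 0) (hf : ContDiff ℝ n f) (hinj : Function.Injective f)
    (hf' : ∀ x, HasFDerivAt f (f' x : E →L[ℝ] F) x) :
    ∃ Φ : OpenPartialHomeomorph E F, ⇑Φ = f ∧ Φ.source = Set.univ ∧
      ContDiffOn ℝ n Φ.symm Φ.target := by
  have hopen : IsOpenMap f := isOpenMap_iff_nhds_le.2 fun x =>
    (hf.contDiffAt.hasStrictFDerivAt' (hf' x) hn).map_nhds_eq_of_equiv.ge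
  let Φ := (Topology.IsOpenEmbedding.of_continuous_injective_isOpenMap hf.continuous hinj
    hopen).toOpenPartialHomeomorph f
  exact ⟨Φ, rfl, rfl, fun y hy =>
    (Φ.contDiffAt_symm hy (hf' (Φ.symm y)) hf.contDiffAt).contDiffWithinAt⟩

theorem isSmoothSubmanifold_preimage {Φ : OpenPartialHomeomorph E F}
    (hsource : Φ.source = Set.univ) (hΦ : ContDiffOn ℝ ∞ Φ Φ.source)
    (hsymm : ContDiffOn ℝ ∞ Φ.symm Φ.target) (L : F ≃L[ℝ] E) (W : Submodule ℝ F) :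
    IsSmoothSubmanifold (Φ ⁻¹' W) := by
  refine ⟨W.comap L.symm.toLinearMap, fun x _ =>
    ⟨Φ.transHomeomorph L.toHomeomorph, ?_, ?_, ?_, fun y _ => ?_⟩⟩
  · exact hsource ▸ Set.mem_univ x
  · exact L.contDiff.comp_contDiffOn hΦ
  · exact hsymm.comp L.symm.contDiff.contDiffOn fun _ h => h
  · change _ ↔ L.symm (L (Φ y)) ∈ W
    rw [L.symm_apply_apply, Set.mem_preimage, SetLike.mem_coe]

end Diffeomorphisms

section Curvature

variable {V : Type*} [Fintype V] [DecidableEq V] {G : ChainGraph V} {r : V → ℕ}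
  [∀ v, NeZero (r v)]

theorem exists_openPartialHomeomorph_paramMap (o : G.ConsistentOrder) :
    ∃ Φ : OpenPartialHomeomorph (NatParam r) (FreeIndex o r → ℝ), ⇑Φ = paramMap o ∧
      Φ.source = Set.univ ∧ ContDiffOn ℝ ∞ Φ.symm Φ.target :=
  exists_openPartialHomeomorph_of_contDiff (f' := fun θ => (LinearMap.linearEquivOfInjective
      (fderiv ℝ (paramMap o) θ).toLinearMap (fderiv_paramMap_injective o θ)
      (finrank_natParam_eq o)).toContinuousLinearEquiv) (by simp) (contDiff_paramMap o)
    (paramMap_injective o) fun θ => ((contDiff_paramMap o).differentiable (by simp) θ).hasFDerivAt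

theorem modelMR_eq_image_expDist (o : G.ConsistentOrder) : modelMR G o r =
    expDist '' {θ | ∀ x : FreeIndex o r, IsConstrained x.1 → paramMap o θ x = 0} := by
  have hpre : expDist ⁻¹' modelMR G o r =
      {θ | ∀ x : FreeIndex o r, IsConstrained x.1 → paramMap o θ x = 0} := by
    ext θ
    exact (and_iff_right (isPositiveDist_expDist θ)).trans
      (mrMarkov_iff_mrParam_eq_zero (isPositiveDist_expDist θ).1)
  rw [← hpre, Set.image_preimage_eq_of_subset]
  rw [range_expDist]
  exact fun p hp => hp.1

theorem isCurvedExponentialFamily_modelMR (o : G.ConsistentOrder) :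
    IsCurvedExponentialFamily (modelMR G o r) := by
  obtain ⟨Φ, hΦ, hsource, hsymm⟩ := exists_openPartialHomeomorph_paramMap (r := r) o
  let W : Submodule ℝ (FreeIndex o r → ℝ) := Submodule.pi {x | IsConstrained x.1} fun _ => ⊥
  have hW : paramMap o ⁻¹' W = {θ | ∀ x : FreeIndex o r, IsConstrained x.1 →
      paramMap o θ x = 0} := Set.ext fun θ =>
    Submodule.mem_pi.trans (forall₂_congr fun _ _ => Submodule.mem_bot ℝ)
  refine ⟨Φ ⁻¹' W, isSmoothSubmanifold_preimage hsource ?_ hsymm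
    (ContinuousLinearEquiv.ofFinrankEq (finrank_natParam_eq o).symm) W, ?_⟩
  · exact hΦ ▸ (contDiff_paramMap o).contDiffOn
  · rw [hΦ, hW, modelMR_eq_image_expDist]

end Curvature

theorem theorem2 {V : Type*} [Fintype V] [DecidableEq V] (G : ChainGraph V)
    (o : G.ConsistentOrder) (r : V → ℕ) [∀ v, NeZero (r v)] :
    -- the parameters of the saturated model are well defined
    (∀ p : Cell r → ℝ, IsPositiveDist p → ∃! β : ParamIndex o r → ℝ, IsSaturatedParam o p β) ∧
    -- the model is given by zero constraints on them
    (∀ (p : Cell r → ℝ) (β : ParamIndex o r → ℝ), IsPositiveDist p → IsSaturatedParam o p β →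
      (p ∈ modelMR G o r ↔ ∀ x, IsConstrained x → β x = 0)) ∧
    -- they are a smooth parameterization, in which the model is defined by linear constraints
    (∃ Φ : OpenPartialHomeomorph (NatParam r) (FreeIndex o r → ℝ),
      Φ.source = Set.univ ∧ ContDiffOn ℝ ∞ Φ Φ.source ∧ ContDiffOn ℝ ∞ Φ.symm Φ.target ∧
      (∀ θ β, IsSaturatedParam o (expDist θ) β → ∀ x : FreeIndex o r, Φ θ x = β x.1) ∧
      modelMR G o r =
        expDist '' {θ | ∀ x : FreeIndex o r, IsConstrained x.1 → Φ θ x = 0}) ∧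
    IsCurvedExponentialFamily (modelMR G o r) := by
  refine ⟨fun p _ => ⟨mrParam o p, isSaturatedParam_mrParam o p, fun β hβ => hβ.eq_mrParam⟩,
    fun p β hp hβ => ?_, ?_, isCurvedExponentialFamily_modelMR o⟩
  · rw [hβ.eq_mrParam]
    exact ⟨fun h x hx => (h.2.isContrastMarkov hp.1).mrParam_eq_zero hx,
      fun h => ⟨hp, (mrMarkov_iff_mrParam_eq_zero hp.1).2 fun x hx => h x.1 hx⟩⟩
  · obtain ⟨Φ, hΦ, hsource, hsymm⟩ := exists_openPartialHomeomorph_paramMap (r := r) o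
    refine ⟨Φ, hsource, hΦ ▸ (contDiff_paramMap o).contDiffOn, hsymm, fun θ β hβ x => ?_, ?_⟩
    · rw [hΦ, hβ.eq_mrParam, paramMap]
    · rw [hΦ, modelMR_eq_image_expDist]
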